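/- **Corollary 3.4 (omnibus characterization of $p$-null sequences).** Let $1\le p<\infty$, let $1/p+1/p^*=1$, and let all Banach spaces be over the same field $\mathbb K\in\{\mathbb R,\mathbb C\}$. Let $\ell_p(X)$ be the space of absolutely $p$-summable sequences in $X$ with its norm $\|\cdot\|_p$. For $(z_k)\in\ell_p(X)$ put $$p\text{-conv}(z_k)=\Big\{\sum_{k=1}^\infty a_kz_k : (a_k)\in B\Big\},$$ where $B$ is the closed unit ball of $\ell_{p^*}$ if $p>1$, and of $c_0$ if $p=1$. A sequence $(x_n)$ in a Banach space $X$ is called *$p$-null* if for every $\varepsilon>0$ there are $(z_k)\in\ell_p(X)$ with $\|(z_k)\|_p\le\varepsilon$ and $N\in\mathbb N$ such that $x_n\in p\text{-conv}(z_k)$ for all $n\ge N$. It is *uniformly $p$-null* if there is $(z_k)\in\ell_p(X)$ with $\|(z_k)\|_p\le1$ such that for every $\varepsilon>0$ there is $N\in\mathbb N$ with $x_n\in\varepsilon\,p\text{-conv}(z_k)$ for all $n\ge N$. It is *null* if $x_n\to0$ in norm. A set $K\subset X$ is *relatively $p$-compact* if $K\subset p\text{-conv}(z_k)$ for some $(z_k)\in\ell_p(X)$.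 For Banach spaces $Y,X$ and a bounded linear operator $T:Y\to X$: * $T\in\mathcal N^p(Y,X)$ (right $p$-nuclear) if $T=\sum_n\sigma_n f_n\otimes x_n$, where $(\sigma_n)\in\ell_p$, $(f_n)$ is weakly $p^*$-summable in $Y^*$ (bounded, if $p=1$), and $(x_n)$ is bounded in $X$; * $T\in\mathcal K_p(Y,X)$ if $T$ maps the closed unit ball of $Y$ onto a relatively $p$-compact set; * $T\in\mathcal P_p(Y,X)$ (absolutely $p$-summing) if there is $C\ge0$ such that $\big(\sum_{i=1}^m\|Ty_i\|^p\big)^{1/p}\le C\sup_{\|\varphi\|_{Y^*}\le1}\big(\sum_{i=1}^m|\varphi(y_i)|^p\big)^{1/p}$ for all finite families $y_1,\dots,y_m\in Y$; * $T\in\mathcal P_p^{\mathrm{dual}}(Y,X)$ if the adjoint $T^*:X^*\to Y^*$ belongs to $\mathcal P_p(X^*,Y^*)$. For $\mathcal A\in\{\mathcal N^p,\mathcal K_p,\mathcal P_p^{\mathrm{dual}}\}$, a sequence $(x_n)$ in $X$ is *$\mathcal A$-null* if there are a Banach space $Y$, a null sequence $(y_n)$ in $Y$ and $T\in\mathcal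 A(Y,X)$ with $x_n=Ty_n$ for all $n$. A set $K\subset X$ is *$\mathcal A$-compact* if $K\subset T(F)$ for some Banach space $Y$, some relatively compact $F\subset Y$ and some $T\in\mathcal A(Y,X)$. A sequence is called relatively $p$-compact or $\mathcal A$-compact if the set of its terms is. For every sequence $(x_n)$ in a Banach space $X$ the following statements are equivalent: (a) $(x_n)$ is $p$-null; (b) $(x_n)$ is null and relatively $p$-compact; (c) $(x_n)$ is null and $\mathcal N^p$-compact; (d) $(x_n)$ is null and $\mathcal K_p$-compact; (e) $(x_n)$ is null and $\mathcal P_p^{\mathrm{dual}}$-compact; (f) $(x_n)$ is $\mathcal N^p$-null; (g) $(x_n)$ is $\mathcal K_p$-null; (h) $(x_n)$ is $\mathcal P_p^{\mathrm{dual}}$-null; (i) $(x_n)$ is uniformly $p$-null. -/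

import Mathlib

open Filter Topology
open scoped ENNReal Pointwise

universe u

noncomputable section

/-- A class of bounded linear operators between arbitrary Banach spaces over `𝕜`:
`A Y X` is the component `A(Y, X)`. -/
abbrev OperatorClass (𝕜 : Type) [RCLike 𝕜] :=
  ∀ (Y X : Type u) [NormedAddCommGroup Y] [NormedSpace 𝕜 Y] [CompleteSpace Y]
    [NormedAddCommGroup X] [NormedSpace 𝕜 X] [CompleteSpace X], Set (Y →L[𝕜] X)

section Sets

variable (𝕜 : Type) [RCLike 𝕜] {X : Type u} [NormedAddCommGroup X] [NormedSpace 𝕜 X]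

/-- The `p`-convex hull `{∑ aₖ zₖ : a ∈ B}` of `z ∈ ℓ_p(X)`, where `B` is the closed unit ball of
`ℓ_{p*}` if `p > 1`, and of `c₀` if `p = 1` (that is, `p* = ∞`). The series converge absolutely. -/
def pConv (p : ℝ≥0∞) (z : lp (fun _ : ℕ => X) p) : Set X :=
  {v | ∃ a : lp (fun _ : ℕ => 𝕜) p.conjExponent, ‖a‖ ≤ 1 ∧
    (p.conjExponent = ∞ → Tendsto (fun k => a k) atTop (𝓝 0)) ∧
    HasSum (fun k => a k • z k) v}

/-- Relatively `p`-compact sets. -/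
def IsRelPCompact (p : ℝ≥0∞) (K : Set X) : Prop :=
  ∃ z : lp (fun _ : ℕ => X) p, K ⊆ pConv 𝕜 p z

/-- `p`-null sequences. -/
def IsPNull (p : ℝ≥0∞) (x : ℕ → X) : Prop :=
  ∀ ε : ℝ, 0 < ε → ∃ z : lp (fun _ : ℕ => X) p, ‖z‖ ≤ ε ∧
    ∃ N : ℕ, ∀ n ≥ N, x n ∈ pConv 𝕜 p z

/-- Uniformly `p`-null sequences. -/
def IsUniformlyPNull (p : ℝ≥0∞) (x : ℕ → X) : Prop :=
  ∃ z : lp (fun _ : ℕ => X) p, ‖z‖ ≤ 1 ∧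
    ∀ ε : ℝ, 0 < ε → ∃ N : ℕ, ∀ n ≥ N, x n ∈ (ε : 𝕜) • pConv 𝕜 p z

/-- Weakly `q`-summable sequences; for `q = ∞` these are the bounded ones. -/
def IsWeaklySummable (q : ℝ≥0∞) (x : ℕ → X) : Prop :=
  ∀ φ : StrongDual 𝕜 X, Memℓp (fun n => φ (x n)) q

end Sets

section Operators

variable {𝕜 : Type} [RCLike 𝕜] {Y X : Type u} [NormedAddCommGroup Y] [NormedSpace 𝕜 Y]
  [NormedAddCommGroup X] [NormedSpace 𝕜 X]

/-- Right `p`-nuclear operators, i.e. `(p,1,p)`-nuclear operators: `T = ∑ σₙ fₙ ⊗ xₙ` with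
`σ ∈ ℓ_p`, `(fₙ)` weakly `p*`-summable in the dual of `Y`, and `(xₙ)` bounded in `X`.
For such data the series converges unconditionally in operator norm when `X` is complete, so that
the representation may be tested pointwise. -/
def IsRightPNuclear (p : ℝ≥0∞) (T : Y →L[𝕜] X) : Prop :=
  ∃ (σ : ℕ → 𝕜) (f : ℕ → StrongDual 𝕜 Y) (x : ℕ → X),
    Memℓp σ p ∧ IsWeaklySummable 𝕜 p.conjExponent f ∧ (∃ C : ℝ, ∀ n, ‖x n‖ ≤ C) ∧
    ∀ y : Y, HasSum (fun n => σ n • f n y • x n) (T y)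

/-- `p`-compact operators (in the sense of Sinha and Karn). -/
def IsPCompactOperator (p : ℝ≥0∞) (T : Y →L[𝕜] X) : Prop :=
  IsRelPCompact 𝕜 p (T '' Metric.closedBall 0 1)

/-- Absolutely `p`-summing operators (`1 ≤ p < ∞`): for some `C`, all finite families satisfy
`(∑ ‖T yᵢ‖^p)^(1/p) ≤ C * sup_{‖φ‖ ≤ 1} (∑ |φ yᵢ|^p)^(1/p)`. The supremum is expressed through
its upper bounds `w`. -/
def IsAbsolutelyPSumming (p : ℝ≥0∞) (T : Y →L[𝕜] X) : Prop :=
  ∃ C : ℝ, 0 ≤ C ∧ ∀ (m : ℕ) (y : Fin m → Y) (w : ℝ),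
    (∀ φ : StrongDual 𝕜 Y, ‖φ‖ ≤ 1 → (∑ i, ‖φ (y i)‖ ^ p.toReal) ^ (1 / p.toReal) ≤ w) →
    (∑ i, ‖T (y i)‖ ^ p.toReal) ^ (1 / p.toReal) ≤ C * w

/-- The adjoint `T* : X* → Y*`, `φ ↦ φ ∘ T`. -/
def adjointOperator (T : Y →L[𝕜] X) : StrongDual 𝕜 X →L[𝕜] StrongDual 𝕜 Y :=
  (ContinuousLinearMap.compL 𝕜 Y X 𝕜).flip T

end Operators

section Ideals

variable (𝕜 : Type) [RCLike 𝕜] (p : ℝ≥0∞)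

/-- The operator ideal `N^p` of right `p`-nuclear operators. -/
def rightPNuclear : OperatorClass.{u} 𝕜 :=
  fun Y X _ _ _ _ _ _ => {T : Y →L[𝕜] X | IsRightPNuclear p T}

/-- The operator ideal `K_p` of `p`-compact operators. -/
def pCompact : OperatorClass.{u} 𝕜 :=
  fun Y X _ _ _ _ _ _ => {T : Y →L[𝕜] X | IsPCompactOperator p T}

/-- The operator ideal `P_p` of absolutely `p`-summing operators. -/
def pSumming : OperatorClass.{u} 𝕜 :=
  fun Y X _ _ _ _ _ _ => {T : Y →L[𝕜] X | IsAbsolutelyPSumming p T}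

variable {𝕜}

/-- The dual ideal `A^dual`: the operators whose adjoint belongs to `A`. -/
def OperatorClass.dual (A : OperatorClass.{u} 𝕜) : OperatorClass.{u} 𝕜 :=
  fun Y X _ _ _ _ _ _ =>
    {T : Y →L[𝕜] X | adjointOperator T ∈ A (StrongDual 𝕜 X) (StrongDual 𝕜 Y)}

variable {X : Type u} [NormedAddCommGroup X] [NormedSpace 𝕜 X] [CompleteSpace X]

/-- `A`-null sequences: images of null sequences under an operator from `A`. -/
def OperatorClass.IsNullSeq (A : OperatorClass.{u} 𝕜) (x : ℕ → X) : Prop :=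
  ∃ (Y : Type u) (_ : NormedAddCommGroup Y) (_ : NormedSpace 𝕜 Y) (_ : CompleteSpace Y)
    (y : ℕ → Y) (T : Y →L[𝕜] X),
    T ∈ A Y X ∧ Tendsto y atTop (𝓝 0) ∧ ∀ n, x n = T (y n)

/-- `A`-compact sets: subsets of images of relatively compact sets under an operator from `A`. -/
def OperatorClass.IsCompactSet (A : OperatorClass.{u} 𝕜) (K : Set X) : Prop :=
  ∃ (Y : Type u) (_ : NormedAddCommGroup Y) (_ : NormedSpace 𝕜 Y) (_ : CompleteSpace Y)
    (F : Set Y) (T : Y →L[𝕜] X),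
    T ∈ A Y X ∧ IsCompact (closure F) ∧ K ⊆ T '' F

end Ideals

end

/-! For an arbitrary class of operators `A`, a null sequence that is `A`-compact is already
`A`-null: its preimages, taken in a relatively compact set, approach the kernel, so subtracting
suitable kernel elements makes them null. Thus (c), (d), (e) are (f), (g), (h). Since N^p ⊆ K_p ⊆
P_p^dual, the substance is the way back from P_p^dual-null to uniformly p-null.

Let x_n = T y_n with T* absolutely p-summing and y_n → 0. If functionals ψ_i satisfy ∑|ψ_i(u)|^p ≤ 1
on the unit ball, then ∑‖T*ψ_i‖^p ≤ C^p, so ∑|ψ_i(x_i)|^p is small over any finite block of late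
terms, whatever its length. Two Hahn–Banach separations, one in ℝ^ι and one in X^ι, convert this
into membership of the whole block in the p-convex hull of one small sequence
(`exists_inHull_of_forall_dominated`).

Consecutive blocks with tolerances 4^{-j} are then inflated by 2^j and concatenated: a single
p-summable sequence whose hull, multiplied by scalars tending to 0, contains the terms
(`IsLocallyPNull.isHullNull`). This is uniform p-nullity up to normalization, and the coefficient
sequences form a null sequence in ℓ_{p*}, so x is also N^p-null. -/

/-! ### Dual norms tested on finite families, uniformly in p ≥ 1 -/

section DualBound

variable {𝕜 : Type} [RCLike 𝕜] {ι κ : Type*}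

/-- The inequality `‖a‖_{r*} ≤ M` for the dual exponent `r*` of `r`, expressed by duality against
finitely supported nonnegative families. -/
def DualBound (r M : ℝ) (a : ι → 𝕜) : Prop :=
  ∀ (s : Finset ι) (b : ι → ℝ), (∀ k, 0 ≤ b k) →
    ∑ k ∈ s, ‖a k‖ * b k ≤ M * (∑ k ∈ s, b k ^ r) ^ (1 / r)

theorem DualBound.mono {r M M' : ℝ} {a : ι → 𝕜} (h : DualBound r M a) (hM : M ≤ M') :
    DualBound r M' a := fun s b hb => (h s b hb).trans <| by
  gcongr
  exact Real.rpow_nonneg (Finset.sum_nonneg fun k _ => Real.rpow_nonneg (hb k) _) _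

theorem DualBound.smul {r M : ℝ} {a : ι → 𝕜} (h : DualBound r M a) (c : 𝕜) :
    DualBound r (‖c‖ * M) (fun k => c * a k) := fun s b hb => by
  have := mul_le_mul_of_nonneg_left (h s b hb) (norm_nonneg c)
  simpa only [norm_mul, mul_assoc, Finset.mul_sum] using this

theorem DualBound.mul_bounded {r M C : ℝ} {a c : ι → 𝕜} (h : DualBound r M a) (hC : 0 ≤ C)
    (hc : ∀ k, ‖c k‖ ≤ C) : DualBound r (C * M) (fun k => c k * a k) := fun s b hb => by
  have := mul_le_mul_of_nonneg_left (h s b hb) hC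
  rw [mul_assoc]
  refine le_trans ?_ this
  rw [Finset.mul_sum]
  refine Finset.sum_le_sum fun k _ => ?_
  rw [norm_mul, mul_assoc]
  exact mul_le_mul_of_nonneg_right (hc k) (mul_nonneg (norm_nonneg _) (hb k))

theorem DualBound.norm_le {r M : ℝ} {a : ι → 𝕜} (h : DualBound r M a) (k : ι) :
    ‖a k‖ ≤ M := by
  simpa using h {k} (fun _ => 1) (fun _ => zero_le_one)

theorem DualBound.extend {r M : ℝ} {a : ι → 𝕜} (h : DualBound r M a) (hM : 0 ≤ M)
    (hr : 0 < r) {e : ι → κ} (he : e.Injective) :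
    DualBound r M (Function.extend e a 0) := fun s b hb => by
  classical
  have h1 := h (s.preimage e he.injOn) (b ∘ e) (fun k => hb _)
  have h2 : ∑ k ∈ s, ‖Function.extend e a 0 k‖ * b k
      = ∑ k ∈ s.preimage e he.injOn, ‖a k‖ * b (e k) := by
    symm
    refine (Finset.sum_congr rfl fun k _ => ?_).trans
      (Finset.sum_preimage e s he.injOn (fun k => ‖Function.extend e a 0 k‖ * b k) ?_)
    · rw [he.extend_apply]
    · intro k _ hk
      rw [Function.extend_apply' _ _ _ (by simpa using hk)]
      simp
  rw [h2]
  refine h1.trans (mul_le_mul_of_nonneg_left (Real.rpow_le_rpow ?_ ?_ (by positivity)) hM)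
  · exact Finset.sum_nonneg fun k _ => Real.rpow_nonneg (hb _) _
  · refine (Finset.sum_image (g := e) (f := fun k => b k ^ r) he.injOn).symm.trans_le ?_
    refine Finset.sum_le_sum_of_subset_of_nonneg ?_ fun k _ _ => Real.rpow_nonneg (hb _) _
    intro k hk
    obtain ⟨i, hi, rfl⟩ := Finset.mem_image.1 hk
    simpa using hi

/-- The constant `L` is left to `hL` because two combinations are needed: a sharp one for convexity
of the hull and a crude `1 + 1 ≤ 2` for absorbing an error. -/
theorem DualBound.sum_elim {r M M' : ℝ} {a : ι → 𝕜} {a' : κ → 𝕜}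
    (h : DualBound r M a) (h' : DualBound r M' a') {L : ℝ} (hL : ∀ u v : ℝ, 0 ≤ u → 0 ≤ v →
      M * u ^ (1 / r) + M' * v ^ (1 / r) ≤ L * (u + v) ^ (1 / r)) :
    DualBound r L (Sum.elim a a') := fun s b hb => by
  classical
  have e : ∀ f : ι ⊕ κ → ℝ, ∑ k ∈ s, f k
      = ∑ k ∈ s.toLeft, f (.inl k) + ∑ k ∈ s.toRight, f (.inr k) := fun f => by
    conv_lhs => rw [← Finset.toLeft_disjSum_toRight (u := s)]
    rw [Finset.sum_disjSum]
  rw [e, e]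
  refine le_trans (add_le_add (h s.toLeft (b ∘ .inl) fun k => hb _)
    (h' s.toRight (b ∘ .inr) fun k => hb _)) ?_
  exact hL _ _ (Finset.sum_nonneg fun k _ => Real.rpow_nonneg (hb _) _)
    (Finset.sum_nonneg fun k _ => Real.rpow_nonneg (hb _) _)

variable {p : ℝ≥0∞}

theorem one_le_toReal (hp1 : 1 ≤ p) (hp : p ≠ ∞) : 1 ≤ p.toReal := by
  simpa using ENNReal.toReal_mono hp hp1

theorem one_le_conjExponent (p : ℝ≥0∞) : 1 ≤ p.conjExponent := by
  simp [ENNReal.conjExponent]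

theorem conjExponent_cases (hp1 : 1 ≤ p) (hp : p ≠ ∞) :
    (p.toReal = 1 ∧ p.conjExponent = ∞) ∨
      (p.conjExponent ≠ ∞ ∧ p.toReal.HolderConjugate p.conjExponent.toReal) := by
  rcases hp1.eq_or_lt with rfl | h
  · left; simp [ENNReal.conjExponent]
  · right
    have hc : p.conjExponent ≠ ∞ := by
      simp [ENNReal.conjExponent, tsub_eq_zero_iff_le, h]
    have := ENNReal.HolderConjugate.conjExponent hp1
    refine ⟨hc, ?_⟩
    exact ENNReal.HolderConjugate.toReal_of_ne_top hp hc

theorem dualBound_lp (hp1 : 1 ≤ p) (hp : p ≠ ∞) (a : lp (fun _ : ι => 𝕜) p.conjExponent) :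
    DualBound p.toReal ‖a‖ (fun k => a k) := fun s b hb => by
  have hq0 : p.conjExponent ≠ 0 := (zero_lt_one.trans_le (one_le_conjExponent p)).ne'
  rcases conjExponent_cases hp1 hp with ⟨h1, _⟩ | ⟨hc, hh⟩
  · simp only [h1, Real.rpow_one, div_one, Finset.mul_sum]
    exact Finset.sum_le_sum fun k _ =>
      mul_le_mul_of_nonneg_right (lp.norm_apply_le_norm hq0 a k) (hb k)
  · refine (Real.inner_le_Lp_mul_Lq s (fun k => ‖a k‖) b hh.symm).trans ?_
    simp only [abs_norm, abs_of_nonneg (hb _)]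
    refine mul_le_mul_of_nonneg_right ?_
      (Real.rpow_nonneg (Finset.sum_nonneg fun k _ => Real.rpow_nonneg (hb _) _) _)
    have h2 := lp.sum_rpow_le_norm_rpow hh.symm.pos a s
    calc _ ≤ (‖a‖ ^ p.conjExponent.toReal) ^ (1 / p.conjExponent.toReal) :=
          Real.rpow_le_rpow (Finset.sum_nonneg fun k _ => Real.rpow_nonneg (norm_nonneg _) _) h2
            (one_div_nonneg.2 hh.symm.nonneg)
      _ = ‖a‖ := by
        rw [← Real.rpow_mul (lp.norm_nonneg' a), mul_one_div_cancel hh.symm.ne_zero, Real.rpow_one]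

theorem DualBound.sum_rpow_le {r q : ℝ} (hh : r.HolderConjugate q) {M : ℝ} (hM : 0 ≤ M)
    {a : ι → 𝕜} (h : DualBound r M a) (s : Finset ι) : ∑ k ∈ s, ‖a k‖ ^ q ≤ M ^ q := by
  -- The equality case of Hölder's inequality.
  have h1 := h s (fun k => ‖a k‖ ^ (q - 1)) fun k => Real.rpow_nonneg (norm_nonneg _) _
  have hq := hh.symm.pos
  have e1 : ∀ k, ‖a k‖ * ‖a k‖ ^ (q - 1) = ‖a k‖ ^ q := fun k => by
    rw [← Real.rpow_one_add' (norm_nonneg _) (by simpa using hq.ne')]; ring_nf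
  have e2 : ∀ k, (‖a k‖ ^ (q - 1)) ^ r = ‖a k‖ ^ q := fun k => by
    rw [← Real.rpow_mul (norm_nonneg _)]; congr 1
    have := hh.symm.sub_one_mul_conj; linarith
  simp only [e1, e2] at h1
  set S := ∑ k ∈ s, ‖a k‖ ^ q with hS
  have hS0 : 0 ≤ S := Finset.sum_nonneg fun k _ => Real.rpow_nonneg (norm_nonneg _) _
  rcases hS0.eq_or_lt with h0 | h0
  · rw [← h0]; positivity
  have h3 : S ^ (1 / q) ≤ M := by
    have e3 : S = S ^ (1 / q) * S ^ (1 / r) := by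
      rw [← Real.rpow_add h0]
      have := hh.symm.inv_add_inv_eq_one
      simp [this]
    have h4 : 0 < S ^ (1 / r) := Real.rpow_pos_of_pos h0 _
    refine le_of_mul_le_mul_right ?_ h4
    rw [← e3]; exact h1
  calc S = (S ^ (1 / q)) ^ q := by
        rw [← Real.rpow_mul hS0, one_div_mul_cancel hq.ne', Real.rpow_one]
    _ ≤ M ^ q := Real.rpow_le_rpow (Real.rpow_nonneg hS0 _) h3 hq.le

theorem DualBound.memℓp (hp1 : 1 ≤ p) (hp : p ≠ ∞) {M : ℝ} (hM : 0 ≤ M) {a : ι → 𝕜}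
    (h : DualBound p.toReal M a) : Memℓp a p.conjExponent := by
  rcases conjExponent_cases hp1 hp with ⟨h1, h2⟩ | ⟨hc, hh⟩
  · rw [h2]
    refine memℓp_infty ⟨M, ?_⟩
    rintro _ ⟨k, rfl⟩
    exact h.norm_le k
  · exact memℓp_gen' fun s => h.sum_rpow_le hh hM s

theorem DualBound.norm_lp_le (hp1 : 1 ≤ p) (hp : p ≠ ∞) {M : ℝ} (hM : 0 ≤ M)
    {a : lp (fun _ : ι => 𝕜) p.conjExponent}
    (h : DualBound p.toReal M (fun k => a k)) : ‖a‖ ≤ M := by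
  rcases conjExponent_cases hp1 hp with ⟨h1, h2⟩ | ⟨hc, hh⟩
  · revert a
    rw [h2]
    intro a h
    exact lp.norm_le_of_forall_le hM h.norm_le
  · exact lp.norm_le_of_forall_sum_le hh.symm.pos hM fun s => h.sum_rpow_le hh hM s

/-- The coefficients are the coordinates of a norming functional of `b` on the finite-dimensional
ℓ_p, which treats p = 1 and p > 1 at once. -/
theorem exists_dualBound_sum_eq [Fintype ι] (hp1 : 1 ≤ p) (hp : p ≠ ∞) (b : ι → 𝕜) :
    ∃ a : ι → 𝕜, DualBound p.toReal 1 a ∧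
      ∑ k, a k * b k = (((∑ k, ‖b k‖ ^ p.toReal) ^ (1 / p.toReal) : ℝ) : 𝕜) := by
  classical
  have : Fact (1 ≤ p) := ⟨hp1⟩
  have hr : 0 < p.toReal := zero_lt_one.trans_le (one_le_toReal hp1 hp)
  have rep : ∀ (g : StrongDual 𝕜 (PiLp p fun _ : ι => 𝕜)) (c : ι → 𝕜),
      g (WithLp.toLp p c) = ∑ k, g (WithLp.toLp p (Pi.single k 1)) * c k := fun g c => by
    have : (WithLp.toLp p c : PiLp p fun _ : ι => 𝕜)
        = ∑ k, c k • WithLp.toLp p (Pi.single k (1 : 𝕜)) := by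
      ext j
      simp [Pi.single_apply]
    rw [this, map_sum]
    simp [mul_comm]
  obtain ⟨g, hg1, hg2⟩ := exists_dual_vector'' 𝕜 (WithLp.toLp p b : PiLp p fun _ : ι => 𝕜)
  refine ⟨fun k => g (WithLp.toLp p (Pi.single k 1)), fun s c hc => ?_, ?_⟩
  · set a : ι → 𝕜 := fun k => g (WithLp.toLp p (Pi.single k 1)) with ha
    choose θ hθ1 hθ2 using fun k => RCLike.exists_norm_eq_mul_self (K := 𝕜) (a k)
    let d : ι → 𝕜 := fun k => if k ∈ s then θ k * (c k : 𝕜) else 0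
    have e1 : g (WithLp.toLp p d) = ((∑ k ∈ s, ‖a k‖ * c k : ℝ) : 𝕜) := by
      rw [rep]
      simp only [d, mul_ite, mul_zero, Finset.sum_ite_mem, Finset.univ_inter]
      rw [RCLike.ofReal_sum]
      refine Finset.sum_congr rfl fun k _ => ?_
      rw [RCLike.ofReal_mul, hθ2 k]; ring
    have e2 : ‖(WithLp.toLp p d : PiLp p fun _ : ι => 𝕜)‖
        = (∑ k ∈ s, c k ^ p.toReal) ^ (1 / p.toReal) := by
      rw [PiLp.norm_eq_sum hr]
      congr 1
      rw [← Finset.sum_subset (Finset.subset_univ s)]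
      · refine Finset.sum_congr rfl fun k hk => ?_
        simp [d, hk, hθ1, abs_of_nonneg (hc k)]
      · intro k _ hk
        simp [d, hk, Real.zero_rpow hr.ne']
    calc ∑ k ∈ s, ‖a k‖ * c k = ‖g (WithLp.toLp p d)‖ := by
          rw [e1, RCLike.norm_ofReal, abs_of_nonneg]
          exact Finset.sum_nonneg fun k _ => mul_nonneg (norm_nonneg _) (hc k)
      _ ≤ 1 * ‖(WithLp.toLp p d : PiLp p fun _ : ι => 𝕜)‖ := g.le_of_opNorm_le hg1 _
      _ = _ := by rw [e2]
  · rw [← rep, hg2, PiLp.norm_eq_sum hr]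

theorem DualBound.norm_sum_mul_le {r M : ℝ} {a : ι → 𝕜} (h : DualBound r M a) (s : Finset ι)
    (b : ι → 𝕜) : ‖∑ k ∈ s, a k * b k‖ ≤ M * (∑ k ∈ s, ‖b k‖ ^ r) ^ (1 / r) :=
  (norm_sum_le _ _).trans <| by
    simpa only [norm_mul] using h s (fun k => ‖b k‖) fun k => norm_nonneg _

theorem DualBound.summable_mul {r M : ℝ} (hr : 0 < r) (hM : 0 ≤ M) {a : ι → 𝕜}
    (h : DualBound r M a) {b : ι → ℝ} (hb : ∀ k, 0 ≤ b k) (hs : Summable fun k => b k ^ r) :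
    Summable fun k => ‖a k‖ * b k := by
  refine summable_of_sum_le (fun k => mul_nonneg (norm_nonneg _) (hb k))
    (c := M * (∑' k, b k ^ r) ^ (1 / r)) fun s => (h s b hb).trans ?_
  refine mul_le_mul_of_nonneg_left (Real.rpow_le_rpow ?_ ?_ (by positivity)) hM
  · exact Finset.sum_nonneg fun k _ => Real.rpow_nonneg (hb k) _
  · exact hs.sum_le_tsum s fun k _ => Real.rpow_nonneg (hb k) _

theorem DualBound.tsum_mul_le {r M : ℝ} (hr : 0 < r) (hM : 0 ≤ M) {a : ι → 𝕜}
    (h : DualBound r M a) {b : ι → ℝ} (hb : ∀ k, 0 ≤ b k) (hs : Summable fun k => b k ^ r) :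
    ∑' k, ‖a k‖ * b k ≤ M * (∑' k, b k ^ r) ^ (1 / r) := by
  refine (h.summable_mul hr hM hb hs).tsum_le_of_sum_le fun s => (h s b hb).trans ?_
  refine mul_le_mul_of_nonneg_left (Real.rpow_le_rpow ?_ ?_ (by positivity)) hM
  · exact Finset.sum_nonneg fun k _ => Real.rpow_nonneg (hb k) _
  · exact hs.sum_le_tsum s fun k _ => Real.rpow_nonneg (hb k) _

end DualBound

/-! ### p-convex hulls over arbitrary index sets, and gluing of blocks -/

section Hull

variable (𝕜 : Type) [RCLike 𝕜] {ι κ : Type*} {X : Type u} [NormedAddCommGroup X] [NormedSpace 𝕜 X]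

/-- `v = ∑ aₖ zₖ` for some coefficients in `M` times the ball defining the `p`-convex hull. -/
def InHull (p : ℝ≥0∞) (M : ℝ) (z : ι → X) (v : X) : Prop :=
  ∃ a : ι → 𝕜, DualBound p.toReal M a ∧
    (p.conjExponent = ∞ → Tendsto a cofinite (𝓝 0)) ∧ HasSum (fun k => a k • z k) v

variable {𝕜} {p : ℝ≥0∞} {M : ℝ}

theorem mem_pConv_iff (hp1 : 1 ≤ p) (hp : p ≠ ∞) {z : lp (fun _ : ℕ => X) p} {v : X} :
    v ∈ pConv 𝕜 p z ↔ InHull 𝕜 p 1 (fun k => z k) v := by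
  constructor
  · rintro ⟨a, h1, h2, h3⟩
    exact ⟨fun k => a k, (dualBound_lp hp1 hp a).mono h1,
      fun h => by rw [Nat.cofinite_eq_atTop]; exact h2 h, h3⟩
  · rintro ⟨a, h1, h2, h3⟩
    refine ⟨⟨a, h1.memℓp hp1 hp zero_le_one⟩, DualBound.norm_lp_le hp1 hp zero_le_one h1,
      fun h => ?_, h3⟩
    have := h2 h
    rwa [Nat.cofinite_eq_atTop] at this

theorem InHull.mono {M' : ℝ} {z : ι → X} {v : X} (h : InHull 𝕜 p M z v) (hM : M ≤ M') :
    InHull 𝕜 p M' z v :=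
  let ⟨a, h1, h2, h3⟩ := h
  ⟨a, h1.mono hM, h2, h3⟩

theorem InHull.embed (hp1 : 1 ≤ p) (hp : p ≠ ∞) (hM : 0 ≤ M) {e : ι → κ} (he : e.Injective)
    {z : κ → X} {v : X} (h : InHull 𝕜 p M (z ∘ e) v) : InHull 𝕜 p M z v := by
  obtain ⟨a, h1, h2, h3⟩ := h
  refine ⟨Function.extend e a 0,
    h1.extend hM (zero_lt_one.trans_le (one_le_toReal hp1 hp)) he, fun hc => ?_, ?_⟩
  · rw [Metric.tendsto_nhds]
    intro ε hε
    have h4 := Metric.tendsto_nhds.1 (h2 hc) ε hε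
    rw [eventually_cofinite] at h4 ⊢
    refine (h4.image e).subset fun k hk => ?_
    by_cases hk' : ∃ i, e i = k
    · obtain ⟨i, rfl⟩ := hk'
      exact ⟨i, by simpa [he.extend_apply] using hk, rfl⟩
    · simp [Function.extend_apply' _ _ _ hk'] at hk
      exact absurd hε hk.not_gt
  · rw [← he.hasSum_iff]
    · convert h3 using 2 with k
      simp [he.extend_apply]
    · intro k hk
      rw [Function.extend_apply' _ _ _ (by simpa using hk)]
      simp

theorem InHull.rescale {z : ι → X} {v : X} (h : InHull 𝕜 p M z v) {c : 𝕜} (hc : c ≠ 0) :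
    InHull 𝕜 p (‖c‖ * M) (fun k => c⁻¹ • z k) v := by
  obtain ⟨a, h1, h2, h3⟩ := h
  refine ⟨fun k => c * a k, h1.smul c, fun h => ?_, ?_⟩
  · simpa using (h2 h).const_mul c
  · convert h3 using 2 with k
    rw [smul_smul, mul_right_comm, mul_inv_cancel₀ hc, one_mul]

theorem InHull.smul {z : ι → X} {v : X} (h : InHull 𝕜 p M z v) (c : 𝕜) :
    InHull 𝕜 p (‖c‖ * M) z (c • v) := by
  obtain ⟨a, h1, h2, h3⟩ := h
  refine ⟨fun k => c * a k, h1.smul c, fun h => ?_, ?_⟩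
  · simpa using (h2 h).const_mul c
  · simpa only [smul_smul] using h3.const_smul c

theorem inHull_of_fintype [Fintype ι] {z : ι → X} {v : X} {a : ι → 𝕜}
    (h : DualBound p.toReal M a) (hv : v = ∑ k, a k • z k) : InHull 𝕜 p M z v :=
  ⟨a, h, fun _ => by simp [cofinite_eq_bot], by rw [hv]; exact hasSum_fintype _⟩

theorem dualBound_single [DecidableEq ι] {r : ℝ} (hr : 0 < r) (k : ι) :
    DualBound r 1 (Pi.single k (1 : 𝕜)) := fun s b hb => by
  have e : ∀ j, ‖(Pi.single k (1 : 𝕜) : ι → 𝕜) j‖ * b j = if k = j then b j else 0 := fun j => by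
    rcases eq_or_ne k j with rfl | h
    · simp
    · simp [h]
  simp only [e, Finset.sum_ite_eq, one_mul]
  split_ifs with h
  · calc b k = (b k ^ r) ^ (1 / r) := by
          rw [← Real.rpow_mul (hb k), mul_one_div_cancel hr.ne', Real.rpow_one]
      _ ≤ _ := Real.rpow_le_rpow (Real.rpow_nonneg (hb k) _)
          (Finset.single_le_sum (f := fun k => b k ^ r) (fun j _ => Real.rpow_nonneg (hb j) _) h)
          (by positivity)
  · exact Real.rpow_nonneg (Finset.sum_nonneg fun j _ => Real.rpow_nonneg (hb j) _) _

theorem inHull_apply (hp1 : 1 ≤ p) (hp : p ≠ ∞) (z : ι → X) (k : ι) :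
    InHull 𝕜 p 1 z (z k) :=
  InHull.embed hp1 hp zero_le_one (e := fun _ : Unit => k) (fun _ _ _ => rfl) <|
    inHull_of_fintype (a := Pi.single () 1)
      (dualBound_single (zero_lt_one.trans_le (one_le_toReal hp1 hp)) ()) (by simp)

/-- Padding by zeros along an injection into ℕ; it lets hulls be built over products and disjoint
unions. -/
theorem exists_seq_inHull [Countable ι] (hp1 : 1 ≤ p) (hp : p ≠ ∞) (z : ι → X)
    (hz : Summable fun k => ‖z k‖ ^ p.toReal) :
    ∃ z' : ℕ → X, (Summable fun k => ‖z' k‖ ^ p.toReal) ∧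
      ∑' k, ‖z' k‖ ^ p.toReal = ∑' k, ‖z k‖ ^ p.toReal ∧
      ∀ M v, 0 ≤ M → InHull 𝕜 p M z v → InHull 𝕜 p M z' v := by
  have hr : 0 < p.toReal := zero_lt_one.trans_le (one_le_toReal hp1 hp)
  obtain ⟨e, he⟩ := exists_injective_nat ι
  have h0 : ∀ k, k ∉ Set.range e → ‖Function.extend e z 0 k‖ ^ p.toReal = 0 := fun k hk => by
    rw [Function.extend_apply' _ _ _ (by simpa using hk)]
    simp [Real.zero_rpow hr.ne']
  have h1 : (fun k => ‖Function.extend e z 0 k‖ ^ p.toReal) ∘ e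
      = fun k => ‖z k‖ ^ p.toReal := by
    ext k; simp [he.extend_apply]
  have h2 : HasSum (fun k => ‖Function.extend e z 0 k‖ ^ p.toReal)
      (∑' k, ‖z k‖ ^ p.toReal) := by
    rw [← he.hasSum_iff h0, h1]; exact hz.hasSum
  refine ⟨Function.extend e z 0, h2.summable, h2.tsum_eq, fun M v hM h => ?_⟩
  refine InHull.embed hp1 hp hM he ?_
  convert h
  ext k; simp [he.extend_apply]

variable (𝕜)

/-- The terms of `x` lie in multiples, tending to zero, of one `p`-convex hull. -/
def IsHullNull (p : ℝ≥0∞) (x : ℕ → X) : Prop :=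
  ∃ z : ℕ → X, (Summable fun k => ‖z k‖ ^ p.toReal) ∧
    ∃ t : ℕ → ℝ, Tendsto t atTop (𝓝 0) ∧ ∀ n, 0 ≤ t n ∧ InHull 𝕜 p (t n) z (x n)

/-- Finite blocks of late terms of `x` lie in small `p`-convex hulls. -/
def IsLocallyPNull (p : ℝ≥0∞) (x : ℕ → X) : Prop :=
  ∀ ε : ℝ, 0 < ε → ∃ N : ℕ, ∀ L : ℕ, ∃ z : ℕ → X, (Summable fun k => ‖z k‖ ^ p.toReal) ∧
    ∑' k, ‖z k‖ ^ p.toReal ≤ ε ^ p.toReal ∧ ∀ n, N ≤ n → n < L → InHull 𝕜 p 1 z (x n)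

variable {𝕜}

/-- Inflating row r by 2^r shrinks the coefficients by 2^{-r}, and `hS` says that the inflated rows
are still jointly p-summable. -/
theorem isHullNull_of_rows (hp1 : 1 ≤ p) (hp : p ≠ ∞) {x : ℕ → X} (z : ℕ → ℕ → X)
    (hz : ∀ r, Summable fun k => ‖z r k‖ ^ p.toReal)
    (hS : Summable fun r : ℕ => (2 ^ r) ^ p.toReal * ∑' k, ‖z r k‖ ^ p.toReal)
    (row : ℕ → ℕ) (hrow : Tendsto row atTop atTop)
    (hx : ∀ n, InHull 𝕜 p 1 (z (row n)) (x n)) : IsHullNull 𝕜 p x := by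
  let w : ℕ × ℕ → X := fun i => ((2 : 𝕜) ^ i.1) • z i.1 i.2
  have e : ∀ r k, ‖w (r, k)‖ ^ p.toReal = (2 ^ r) ^ p.toReal * ‖z r k‖ ^ p.toReal := fun r k => by
    simp only [w, norm_smul, norm_pow, RCLike.norm_ofNat]
    rw [Real.mul_rpow (by positivity) (norm_nonneg _)]
  have hw : Summable fun i => ‖w i‖ ^ p.toReal := by
    rw [summable_prod_of_nonneg fun i => Real.rpow_nonneg (norm_nonneg _) _]
    simp only [e, tsum_mul_left]
    exact ⟨fun r => (hz r).mul_left _, hS⟩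
  obtain ⟨z', h1, -, h2⟩ := exists_seq_inHull (𝕜 := 𝕜) hp1 hp w hw
  refine ⟨z', h1, fun n => (1 / 2) ^ row n, ?_, fun n => ⟨by positivity, h2 _ _ (by positivity) ?_⟩⟩
  · exact (tendsto_pow_atTop_nhds_zero_of_lt_one (by norm_num) (by norm_num)).comp hrow
  · refine InHull.embed hp1 hp (by positivity) (e := fun k => (row n, k))
      (fun _ _ h => (Prod.ext_iff.1 h).2) ?_
    have := (hx n).rescale (c := (1 / 2 : 𝕜) ^ row n) (by simp)
    convert this using 1
    · simp
    · ext k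
      simp [w]

theorem IsLocallyPNull.isHullNull (hp1 : 1 ≤ p) (hp : p ≠ ∞) {x : ℕ → X}
    (h : IsLocallyPNull 𝕜 p x) : IsHullNull 𝕜 p x := by
  have hr : 0 < p.toReal := zero_lt_one.trans_le (one_le_toReal hp1 hp)
  -- 4^{-j} beats the inflation 2^{j+1}, leaving 2 · 2^{-j}, whose p-th powers are summable.
  choose N hN using fun j : ℕ => h ((1 / 4) ^ j) (by positivity)
  let K : ℕ → ℕ := fun j => ∑ i ∈ Finset.range (j + 1), (N i + 1)
  have hKN : ∀ j, N j ≤ K j := fun j =>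
    (Nat.le_succ _).trans
      (Finset.single_le_sum (f := fun i => N i + 1) (fun _ _ => Nat.zero_le _) (by simp))
  have hK : StrictMono K := strictMono_nat_of_lt_succ fun j => by
    simp only [K]
    rw [Finset.sum_range_succ _ (j + 1)]
    omega
  choose z hz1 hz2 hz3 using fun j : ℕ => hN j (K (j + 1))
  have hex : ∀ n, ∃ j, n < K j := fun n => ⟨n + 1, (Nat.lt_succ_self n).trans_le (hK.id_le _)⟩
  -- Row 0 consists of the finitely many early terms themselves; row j + 1 serves the terms with K j
  -- ≤ n < K (j + 1).
  let pre : ℕ → X := fun k => if k < K 0 then x k else 0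
  let Z : ℕ → ℕ → X := fun r => Nat.casesOn r pre z
  refine isHullNull_of_rows hp1 hp Z ?_ ?_ (fun n => Nat.find (hex n)) ?_ ?_
  · rintro (_ | j)
    · refine summable_of_ne_finset_zero (s := Finset.range (K 0)) fun k hk => ?_
      have : ¬ k < K 0 := by simpa using hk
      simp [Z, pre, this, Real.zero_rpow hr.ne']
    · exact hz1 j
  · rw [← summable_nat_add_iff 1]
    have hg : Summable fun j : ℕ => (2 : ℝ) ^ p.toReal * ((1 / 2) ^ p.toReal) ^ j :=
      (summable_geometric_of_lt_one (by positivity)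
        (Real.rpow_lt_one (by norm_num) (by norm_num) hr)).mul_left _
    refine Summable.of_nonneg_of_le (fun j => ?_) (fun j => ?_) hg
    · exact mul_nonneg (by positivity) (tsum_nonneg fun k => by positivity)
    · refine (mul_le_mul_of_nonneg_left (hz2 j) (by positivity)).trans_eq ?_
      rw [← Real.mul_rpow (by positivity) (by positivity),
        ← Real.rpow_natCast (((1 : ℝ) / 2) ^ p.toReal), ← Real.rpow_mul (by positivity),
        mul_comm p.toReal, Real.rpow_mul (by positivity), Real.rpow_natCast,
        ← Real.mul_rpow (by positivity) (by positivity)]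
      congr 1
      rw [pow_succ, mul_right_comm, ← mul_pow]
      norm_num [mul_comm]
  · rw [tendsto_atTop]
    intro R
    filter_upwards [eventually_ge_atTop (K R)] with n hn
    rw [Nat.le_find_iff]
    intro m hm
    exact not_lt.2 ((hK.monotone hm.le).trans hn)
  · intro n
    have h1 := Nat.find_spec (hex n)
    have h2 := fun m (hm : m < Nat.find (hex n)) => not_lt.1 (Nat.find_min (hex n) hm)
    revert h1 h2
    generalize Nat.find (hex n) = r
    intro h1 h2
    rcases r with _ | j
    · have := inHull_apply (𝕜 := 𝕜) hp1 hp pre n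
      rwa [show pre n = x n from if_pos h1] at this
    · exact hz3 j n ((hKN j).trans (h2 j (Nat.lt_succ_self j))) h1

end Hull

/-! ### Finite families in p-convex hulls, by separation -/

section FiniteFamilies

variable {𝕜 : Type} [RCLike 𝕜] {X : Type u} [NormedAddCommGroup X] [NormedSpace 𝕜 X]

theorem norm_ofReal_smul_rpow {E : Type*} [NormedAddCommGroup E] [NormedSpace 𝕜 E] {r c : ℝ}
    (hr : 0 < r) (hc : 0 ≤ c) (v : E) : ‖((c ^ (1 / r) : ℝ) : 𝕜) • v‖ ^ r = c * ‖v‖ ^ r := by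
  have h : 0 ≤ c ^ (1 / r) := Real.rpow_nonneg hc _
  rw [norm_smul, RCLike.norm_ofReal, abs_of_nonneg h, Real.mul_rpow h (norm_nonneg _),
    ← Real.rpow_mul hc, one_div_mul_cancel hr.ne', Real.rpow_one]

/-- Two-term Hölder inequality via weighted AM-GM; it makes the set of tuples lying in a common hull
convex. -/
theorem rpow_mul_rpow_add_le {r s t u v : ℝ} (hr : 1 ≤ r) (hs : 0 ≤ s) (ht : 0 ≤ t)
    (hst : s + t = 1) (hu : 0 ≤ u) (hv : 0 ≤ v) :
    s ^ (1 - 1 / r) * u ^ (1 / r) + t ^ (1 - 1 / r) * v ^ (1 / r) ≤ (u + v) ^ (1 / r) := by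
  have hr0 : 0 < r := zero_lt_one.trans_le hr
  have h1 : 0 < 1 / r := by positivity
  have h2 : 0 ≤ 1 - 1 / r := sub_nonneg.2 ((div_le_one hr0).2 hr)
  rcases (add_nonneg hu hv).eq_or_lt with h0 | h0
  · have hu0 : u = 0 := by linarith
    have hv0 : v = 0 := by linarith
    simp only [hu0, hv0, Real.zero_rpow h1.ne', add_zero, mul_zero, le_refl]
  set T := u + v with hT
  have key : ∀ s u : ℝ, 0 ≤ s → 0 ≤ u →
      s ^ (1 - 1 / r) * u ^ (1 / r) ≤ ((1 - 1 / r) * s + 1 / r * (u / T)) * T ^ (1 / r) := by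
    intro s u hs hu
    have := Real.geom_mean_le_arith_mean2_weighted h2 h1.le hs (div_nonneg hu h0.le) (by ring)
    calc s ^ (1 - 1 / r) * u ^ (1 / r)
        = s ^ (1 - 1 / r) * (u / T) ^ (1 / r) * T ^ (1 / r) := by
          rw [mul_assoc, ← Real.mul_rpow (div_nonneg hu h0.le) h0.le, div_mul_cancel₀ _ h0.ne']
      _ ≤ _ := mul_le_mul_of_nonneg_right this (Real.rpow_nonneg h0.le _)
  refine (add_le_add (key s u hs hu) (key t v ht hv)).trans_eq ?_
  have e : u / T + v / T = 1 := by rw [← add_div, div_self h0.ne']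
  have : ((1 - 1 / r) * s + 1 / r * (u / T)) + ((1 - 1 / r) * t + 1 / r * (v / T)) = 1 := by
    linear_combination (1 - 1 / r) * hst + (1 / r) * e
  rw [← add_mul, this, one_mul]

/-- First separation. The vector (‖φ_i(x_i)‖^r) lies in the closure of the convex set of vectors
dominated by some (∑_k ‖φ_i(z_k)‖^r): a separating functional would have weights μ_i ≥ 0, and
(μ_i/u)^{1/r} φ_i would violate `hx`. The bound `hφ` then passes to the closure. -/
theorem sum_norm_le_of_forall_dominated {ι : Type} [Fintype ι] {r C : ℝ} (hr : 1 ≤ r) (x : ι → X)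
    (hx : ∀ ψ : ι → StrongDual 𝕜 X, (∀ u, ‖u‖ ≤ 1 → ∑ i, ‖ψ i u‖ ^ r ≤ 1) →
      ∑ i, ‖ψ i (x i)‖ ^ r ≤ 1)
    (φ : ι → StrongDual 𝕜 X)
    (hφ : ∀ (κ : Type) [Fintype κ] (z : κ → X), ∑ k, ‖z k‖ ^ r ≤ 1 →
      ∑ i, (∑ k, ‖φ i (z k)‖ ^ r) ^ (1 / r) ≤ C) :
    ∑ i, ‖φ i (x i)‖ ≤ C := by
  classical
  have hr0 : 0 < r := zero_lt_one.trans_le hr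
  let W : Set (ι → ℝ) := {w | ∃ (κ : Type) (_ : Fintype κ) (z : κ → X), ∑ k, ‖z k‖ ^ r ≤ 1 ∧
    ∀ i, w i ≤ ∑ k, ‖φ i (z k)‖ ^ r}
  have hWconv : Convex ℝ W := by
    rintro w ⟨κ, _, z, hz, hw⟩ w' ⟨κ', _, z', hz', hw'⟩ s t hs ht hst
    refine ⟨κ ⊕ κ', inferInstance, Sum.elim (fun k => ((s ^ (1 / r) : ℝ) : 𝕜) • z k)
      (fun k => ((t ^ (1 / r) : ℝ) : 𝕜) • z' k), ?_, fun i => ?_⟩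
    · simp only [Fintype.sum_sum_type, Sum.elim_inl, Sum.elim_inr, norm_ofReal_smul_rpow hr0 hs,
        norm_ofReal_smul_rpow hr0 ht, ← Finset.mul_sum]
      nlinarith
    · simp only [Fintype.sum_sum_type, Sum.elim_inl, Sum.elim_inr, map_smul,
        norm_ofReal_smul_rpow hr0 hs, norm_ofReal_smul_rpow hr0 ht, ← Finset.mul_sum]
      exact add_le_add (mul_le_mul_of_nonneg_left (hw i) hs) (mul_le_mul_of_nonneg_left (hw' i) ht)
  -- `W` is downward closed, so it has vectors with negative coordinates; these are truncated before
  -- taking roots.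
  let S : Set (ι → ℝ) := {w | ∑ i, (max (w i) 0) ^ (1 / r) ≤ C}
  have hS : IsClosed S := by
    refine isClosed_le (continuous_finsetSum _ fun i _ => ?_) continuous_const
    exact Continuous.rpow_const (by fun_prop) fun _ => Or.inr (by positivity)
  have hWS : W ⊆ S := by
    rintro w ⟨κ, _, z, hz, hw⟩
    refine (Finset.sum_le_sum fun i _ => ?_).trans (hφ κ z hz)
    exact Real.rpow_le_rpow (le_max_right _ _)
      (max_le (hw i) (Finset.sum_nonneg fun k _ => Real.rpow_nonneg (norm_nonneg _) _))
      (by positivity)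
  have hmem : (fun i => ‖φ i (x i)‖ ^ r) ∈ closure W := by
    by_contra hcon
    obtain ⟨f, u, hf1, hf2⟩ :=
      geometric_hahn_banach_closed_point hWconv.closure isClosed_closure hcon
    let μ : ι → ℝ := fun i => f (Pi.single i 1)
    have hf : ∀ w, f w = ∑ i, μ i * w i := fun w => by
      conv_lhs => rw [pi_eq_sum_univ' w]
      simp only [map_sum, map_smul, smul_eq_mul, μ]
      refine Finset.sum_congr rfl fun i _ => ?_
      rw [mul_comm]
    have hu : 0 < u := by
      have : (0 : ι → ℝ) ∈ W := ⟨PEmpty, inferInstance, PEmpty.elim, by simp, by simp⟩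
      simpa using hf1 _ (subset_closure this)
    have hμ : ∀ i, 0 ≤ μ i := fun i => by
      by_contra! hi
      -- The functional takes the value u exactly at this nonpositive vector, against the strict
      -- separation.
      have : (-(u / (-μ i))) • (Pi.single i 1 : ι → ℝ) ∈ W := by
        refine ⟨PEmpty, inferInstance, PEmpty.elim, by simp, fun j => ?_⟩
        have h1 : 0 ≤ u / (-μ i) := div_nonneg hu.le (by linarith)
        have h2 : 0 ≤ (Pi.single i 1 : ι → ℝ) j := by
          rw [Pi.single_apply]; split_ifs <;> norm_num
        simpa using mul_nonneg h1 h2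
      have := hf1 _ (subset_closure this)
      rw [map_smul, smul_eq_mul, show f (Pi.single i 1) = μ i from rfl, ← mul_neg_one,
        mul_assoc, neg_one_mul, div_mul_cancel₀ _ (by linarith)] at this
      exact lt_irrefl _ this
    have hψ : ∀ v : ι → X, ∑ i, ‖((((μ i / u) ^ (1 / r) : ℝ) : 𝕜) • φ i) (v i)‖ ^ r
        = (∑ i, μ i * ‖φ i (v i)‖ ^ r) / u := fun v => by
      rw [Finset.sum_div]
      refine Finset.sum_congr rfl fun i _ => ?_
      rw [smul_apply, norm_ofReal_smul_rpow hr0 (div_nonneg (hμ i) hu.le)]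
      ring
    -- Admissibility of the rescaled functionals comes from the one-term families z = v in `W`.
    have := hx (fun i => (((μ i / u) ^ (1 / r) : ℝ) : 𝕜) • φ i) fun v hv => by
      rw [hψ fun _ => v, div_le_one hu, ← hf fun i => ‖φ i v‖ ^ r]
      refine (hf1 _ (subset_closure ⟨Unit, inferInstance, fun _ => v, ?_, fun i => ?_⟩)).le
      · simpa using Real.rpow_le_one (norm_nonneg _) hv hr0.le
      · simp
    rw [hψ, div_le_one hu, ← hf fun i => ‖φ i (x i)‖ ^ r] at this
    exact absurd hf2 this.not_gt
  have h := closure_minimal hWS hS hmem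
  refine le_trans (Finset.sum_le_sum fun i _ => ?_) h
  rw [max_eq_left (Real.rpow_nonneg (norm_nonneg _) _), ← Real.rpow_mul (norm_nonneg _),
    mul_one_div_cancel hr0.ne', Real.rpow_one]

variable {p : ℝ≥0∞}

/-- Second separation, in X^ι. On the tuples lying in the hull of one finite family of ℓ_p-norm at
most 1, a functional (φ_i) can be made to attain ∑_i (∑_k ‖φ_i(z_k)‖^r)^{1/r}, so the previous lemma
rules out separating x. Both constants 2 pay for x being only in the closure. -/
theorem exists_inHull_of_forall_dominated {ι : Type} [Fintype ι] (hp1 : 1 ≤ p) (hp : p ≠ ∞)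
    (x : ι → X)
    (hx : ∀ ψ : ι → StrongDual 𝕜 X, (∀ u, ‖u‖ ≤ 1 → ∑ i, ‖ψ i u‖ ^ p.toReal ≤ 1) →
      ∑ i, ‖ψ i (x i)‖ ^ p.toReal ≤ 1) :
    ∃ z : ℕ → X, (Summable fun k => ‖z k‖ ^ p.toReal) ∧ ∑' k, ‖z k‖ ^ p.toReal ≤ 2 ∧
      ∀ i, InHull 𝕜 p 2 z (x i) := by
  classical
  have hr := one_le_toReal hp1 hp
  set r := p.toReal with hrdef
  have hr0 : 0 < r := zero_lt_one.trans_le hr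
  let : NormedSpace ℝ X := NormedSpace.restrictScalars ℝ 𝕜 X
  have : IsScalarTower ℝ 𝕜 X := RestrictScalars.isScalarTower ℝ 𝕜 X
  let K : Set (ι → X) := {y | ∃ (κ : Type) (_ : Fintype κ) (z : κ → X) (a : ι → κ → 𝕜),
    ∑ k, ‖z k‖ ^ r ≤ 1 ∧ ∀ i, DualBound r 1 (a i) ∧ y i = ∑ k, a i k • z k}
  have hKconv : Convex ℝ K := by
    rintro y ⟨κ, _, z, a, hz, hy⟩ y' ⟨κ', _, z', a', hz', hy'⟩ s t hs ht hst
    -- A convex weight c is shared between coefficients (exponent 1 - 1/r) and vectors (exponent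
    -- 1/r).
    have hsplit : ∀ c : ℝ, 0 ≤ c →
        ((c ^ (1 - 1 / r) : ℝ) : 𝕜) * ((c ^ (1 / r) : ℝ) : 𝕜) = c := fun c hc => by
      rw [← RCLike.ofReal_mul, ← Real.rpow_add_of_nonneg hc
        (sub_nonneg.2 ((div_le_one hr0).2 hr)) (by positivity), sub_add_cancel, Real.rpow_one]
    refine ⟨κ ⊕ κ', inferInstance, Sum.elim (fun k => ((s ^ (1 / r) : ℝ) : 𝕜) • z k)
      (fun k => ((t ^ (1 / r) : ℝ) : 𝕜) • z' k),
      fun i => Sum.elim (fun k => ((s ^ (1 - 1 / r) : ℝ) : 𝕜) * a i k)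
        (fun k => ((t ^ (1 - 1 / r) : ℝ) : 𝕜) * a' i k), ?_, fun i => ⟨?_, ?_⟩⟩
    · simp only [Fintype.sum_sum_type, Sum.elim_inl, Sum.elim_inr, norm_ofReal_smul_rpow hr0 hs,
        norm_ofReal_smul_rpow hr0 ht, ← Finset.mul_sum]
      nlinarith
    · refine DualBound.sum_elim ((hy i).1.smul _) ((hy' i).1.smul _) fun u v hu hv => ?_
      rw [RCLike.norm_ofReal, RCLike.norm_ofReal, abs_of_nonneg (Real.rpow_nonneg hs _),
        abs_of_nonneg (Real.rpow_nonneg ht _), mul_one, mul_one, one_mul]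
      exact rpow_mul_rpow_add_le hr hs ht hst hu hv
    · have e : ∀ c : ℝ, 0 ≤ c → ∀ (b : 𝕜) (v : X),
          (((c ^ (1 - 1 / r) : ℝ) : 𝕜) * b) • (((c ^ (1 / r) : ℝ) : 𝕜) • v)
            = (c : 𝕜) • b • v := fun c hc b v => by
        rw [smul_smul, mul_right_comm, hsplit c hc, mul_smul]
      simp only [Fintype.sum_sum_type, Sum.elim_inl, Sum.elim_inr, e s hs, e t ht,
        ← Finset.smul_sum, ← (hy i).2, ← (hy' i).2, Pi.add_apply, Pi.smul_apply,
        RCLike.real_smul_eq_coe_smul (K := 𝕜)]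
  have hmem : x ∈ closure K := by
    by_contra hcon
    obtain ⟨f, u, hf1, hf2⟩ :=
      RCLike.geometric_hahn_banach_closed_point (𝕜 := 𝕜) hKconv.closure isClosed_closure hcon
    let φ : ι → StrongDual 𝕜 X := fun i => f.comp (ContinuousLinearMap.single 𝕜 (fun _ => X) i)
    have hf : ∀ y, f y = ∑ i, φ i (y i) := fun y => by
      conv_lhs => rw [← Finset.univ_sum_single y]
      simp [φ]
    have h := sum_norm_le_of_forall_dominated (C := u) hr x hx φ fun κ _ z hz => by
      choose a ha1 ha2 using fun i =>
        exists_dualBound_sum_eq hp1 hp fun k => φ i (z k)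
      have hy : (fun i => ∑ k, a i k • z k) ∈ K := ⟨κ, inferInstance, z, a, hz, fun i => ⟨ha1 i, rfl⟩⟩
      have := (hf1 _ (subset_closure hy)).le
      simp only [hf, map_sum, map_smul, smul_eq_mul, ha2, RCLike.ofReal_re] at this
      exact this
    refine absurd hf2 (not_lt.2 (le_trans ?_ h))
    rw [hf]
    exact (RCLike.re_le_norm _).trans (norm_sum_le _ _)
  obtain ⟨δ, hδ, hδc⟩ : ∃ δ : ℝ, 0 < δ ∧ Fintype.card ι * δ ^ r ≤ 1 := by
    refine ⟨(1 / (Fintype.card ι + 1)) ^ (1 / r), by positivity, ?_⟩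
    rw [← Real.rpow_mul (by positivity), one_div_mul_cancel hr0.ne', Real.rpow_one, mul_one_div,
      div_le_one (by positivity)]
    linarith
  obtain ⟨y, ⟨κ, _, z, a, hz, hy⟩, hxy⟩ := Metric.mem_closure_iff.1 hmem δ hδ
  -- The approximation errors are appended as new vectors; the choice of δ keeps their total r-th
  -- power at most 1.
  let z' : κ ⊕ ι → X := Sum.elim z (fun i => x i - y i)
  have hz' : ∑ k, ‖z' k‖ ^ r ≤ 2 := by
    simp only [z', Fintype.sum_sum_type, Sum.elim_inl, Sum.elim_inr]
    have : ∑ i, ‖x i - y i‖ ^ r ≤ Fintype.card ι * δ ^ r := by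
      rw [← nsmul_eq_mul, ← Finset.card_univ]
      refine Finset.sum_le_card_nsmul _ _ _ fun i _ => ?_
      refine Real.rpow_le_rpow (norm_nonneg _) ?_ hr0.le
      rw [← dist_eq_norm]
      exact (dist_le_pi_dist x y i).trans hxy.le
    linarith
  obtain ⟨w, hw1, hw2, hw3⟩ := exists_seq_inHull (𝕜 := 𝕜) hp1 hp z' (Summable.of_finite)
  refine ⟨w, hw1, ?_, fun i => hw3 _ _ zero_le_two ?_⟩
  · rw [hw2, tsum_fintype]; exact hz'
  · refine inHull_of_fintype (a := Sum.elim (a i) (Pi.single i 1)) ?_ ?_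
    · refine DualBound.sum_elim (hy i).1 (dualBound_single hr0 i) fun u v hu hv => ?_
      have h1 : u ^ (1 / r) ≤ (u + v) ^ (1 / r) :=
        Real.rpow_le_rpow hu (by linarith) (by positivity)
      have h2 : v ^ (1 / r) ≤ (u + v) ^ (1 / r) :=
        Real.rpow_le_rpow hv (by linarith) (by positivity)
      linarith
    · simp [z', Fintype.sum_sum_type, ← (hy i).2, Pi.single_apply]

end FiniteFamilies

/-! ### A-null sequences are the A-compact null sequences -/

section NullSequences

variable {𝕜 : Type} [RCLike 𝕜] {X : Type u} [NormedAddCommGroup X] [NormedSpace 𝕜 X]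
  [CompleteSpace X] {A : OperatorClass.{u} 𝕜} {x : ℕ → X}

/-- Modifying preimages by elements of the kernel turns a bounded `A`-preimage of a null sequence
lying in a relatively compact set into a null sequence. -/
theorem OperatorClass.IsCompactSet.isNullSeq (h : A.IsCompactSet (Set.range x))
    (hx : Tendsto x atTop (𝓝 0)) : A.IsNullSeq x := by
  obtain ⟨Y, _, _, _, F, T, hT, hF, hxF⟩ := h
  choose y hyF hy using fun n => hxF (Set.mem_range_self n)
  let V : Set Y := {v | T v = 0}
  have hV : V.Nonempty := ⟨0, map_zero T⟩
  -- Every cluster point `a` of the preimages satisfies T a = lim x_n = 0.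
  have hdist : Tendsto (fun n => Metric.infDist (y n) V) atTop (𝓝 0) := by
    refine tendsto_of_subseq_tendsto fun ns hns => ?_
    obtain ⟨a, -, ms, hms, ha⟩ :=
      hF.tendsto_subseq (x := y ∘ ns) fun n => subset_closure (hyF (ns n))
    refine ⟨ms, ?_⟩
    have h1 : Tendsto (fun n => T (y (ns (ms n)))) atTop (𝓝 (T a)) :=
      (T.continuous.tendsto a).comp ha
    have h2 : Tendsto (fun n => T (y (ns (ms n)))) atTop (𝓝 0) := by
      simpa only [hy, Function.comp_def] using hx.comp (hns.comp hms.tendsto_atTop)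
    have h3 : a ∈ V := tendsto_nhds_unique h1 h2
    have h4 := ((Metric.continuous_infDist_pt V).tendsto a).comp ha
    rwa [Metric.infDist_zero_of_mem h3] at h4
  choose v hvV hv using fun n : ℕ => (Metric.infDist_lt_iff (x := y n) hV).1
    (lt_add_of_pos_right (Metric.infDist (y n) V) (Nat.one_div_pos_of_nat (α := ℝ) (n := n)))
  refine ⟨Y, _, _, ‹_›, fun n => y n - v n, T, hT, ?_, fun n => ?_⟩
  · refine squeeze_zero_norm (fun n => ?_)
      (by simpa using hdist.add (tendsto_one_div_add_atTop_nhds_zero_nat (𝕜 := ℝ)))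
    rw [← dist_eq_norm]
    simpa using (hv n).le
  · rw [map_sub, hy, show T (v n) = 0 from hvV n, sub_zero]

theorem OperatorClass.IsNullSeq.tendsto (h : A.IsNullSeq x) : Tendsto x atTop (𝓝 0) := by
  obtain ⟨Y, _, _, _, y, T, -, hy, hxy⟩ := h
  rw [show x = T ∘ y from funext hxy, ← map_zero T]
  exact (T.continuous.tendsto 0).comp hy

theorem OperatorClass.IsNullSeq.isCompactSet (h : A.IsNullSeq x) :
    A.IsCompactSet (Set.range x) := by
  obtain ⟨Y, _, _, _, y, T, hT, hy, hxy⟩ := h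
  refine ⟨Y, _, _, ‹_›, Set.range y, T, hT,
    hy.isCompact_insert_range.closure_of_subset (Set.subset_insert _ _), ?_⟩
  rintro _ ⟨n, rfl⟩
  exact ⟨y n, ⟨n, rfl⟩, (hxy n).symm⟩

theorem OperatorClass.isNullSeq_iff :
    A.IsNullSeq x ↔ Tendsto x atTop (𝓝 0) ∧ A.IsCompactSet (Set.range x) :=
  ⟨fun h => ⟨h.tendsto, h.isCompactSet⟩, fun h => h.2.isNullSeq h.1⟩

theorem OperatorClass.IsNullSeq.mono {B : OperatorClass.{u} 𝕜}
    (hAB : ∀ (Y X : Type u) [NormedAddCommGroup Y] [NormedSpace 𝕜 Y] [CompleteSpace Y]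
      [NormedAddCommGroup X] [NormedSpace 𝕜 X] [CompleteSpace X], A Y X ⊆ B Y X)
    (h : A.IsNullSeq x) : B.IsNullSeq x := by
  obtain ⟨Y, _, _, _, y, T, hT, hy, hxy⟩ := h
  exact ⟨Y, _, _, ‹_›, y, T, hAB Y X hT, hy, hxy⟩

end NullSequences

/-! ### Splitting off a null factor from a summable sequence -/

section Factorization

/-- With c_k the square root of the tail R_k, the quotient is at most 2(√R_k - √R_{k+1}), which
telescopes. The added geometric series keeps all tails positive. -/
theorem exists_pos_tendsto_zero_summable_div {w : ℕ → ℝ} (hw0 : ∀ k, 0 ≤ w k) (hw : Summable w) :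
    ∃ c : ℕ → ℝ, (∀ k, 0 < c k) ∧ Tendsto c atTop (𝓝 0) ∧ Summable fun k => w k / c k := by
  let v : ℕ → ℝ := fun k => w k + (1 / 2) ^ k
  have hv0 : ∀ k, 0 < v k := fun k => add_pos_of_nonneg_of_pos (hw0 k) (by positivity)
  have hv : Summable v := hw.add summable_geometric_two
  let R : ℕ → ℝ := fun k => ∑' j, v (j + k)
  have hRs : ∀ k, R k = v k + R (k + 1) := fun k => by
    have := ((summable_nat_add_iff k).2 hv).tsum_eq_zero_add
    simpa [R, add_assoc, add_comm 1 k] using this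
  have hR0 : ∀ k, 0 < R k := fun k =>
    ((summable_nat_add_iff k).2 hv).tsum_pos (fun j => (hv0 _).le) 0 (hv0 _)
  refine ⟨fun k => √(R k), fun k => Real.sqrt_pos.2 (hR0 k), ?_, ?_⟩
  · simpa using (tendsto_sum_nat_add v).sqrt
  · have key : ∀ k, w k / √(R k) ≤ 2 * (√(R k) - √(R (k + 1))) := fun k => by
      have h1 := Real.sqrt_pos.2 (hR0 k)
      have h2 := Real.sqrt_le_sqrt (show R (k + 1) ≤ R k by linarith [hRs k, hv0 k])
      have h3 := Real.sq_sqrt (hR0 k).le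
      have h4 := Real.sq_sqrt (hR0 (k + 1)).le
      have h5 : w k ≤ v k := le_add_of_nonneg_right (by positivity)
      rw [div_le_iff₀ h1]
      nlinarith [hRs k]
    refine summable_of_sum_range_le (c := 2 * √(R 0))
      (fun k => div_nonneg (hw0 k) (Real.sqrt_nonneg _)) fun n => ?_
    refine (Finset.sum_le_sum fun k _ => key k).trans ?_
    rw [← Finset.mul_sum, Finset.sum_range_sub']
    have := Real.sqrt_nonneg (R n)
    linarith

theorem exists_tendsto_zero_summable_inv_smul {𝕜 E : Type*} [RCLike 𝕜] [NormedAddCommGroup E]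
    [NormedSpace 𝕜 E] {r : ℝ} (hr : 0 < r) {z : ℕ → E} (hz : Summable fun k => ‖z k‖ ^ r) :
    ∃ c : ℕ → 𝕜, (∀ k, c k ≠ 0) ∧ Tendsto c atTop (𝓝 0) ∧
      Summable fun k => ‖(c k)⁻¹ • z k‖ ^ r := by
  obtain ⟨c, hc0, hc, hs⟩ := exists_pos_tendsto_zero_summable_div
    (fun k => Real.rpow_nonneg (norm_nonneg (z k)) r) hz
  refine ⟨fun k => ((c k ^ (1 / r) : ℝ) : 𝕜), fun k => ?_, ?_, ?_⟩
  · simpa using (Real.rpow_pos_of_pos (hc0 k) _).ne'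
  · have := hc.rpow_const (p := 1 / r) (Or.inr (by positivity))
    rw [Real.zero_rpow (by positivity)] at this
    simpa [Function.comp_def] using ((RCLike.continuous_ofReal (K := 𝕜)).tendsto 0).comp this
  · convert hs using 2 with k
    have h := Real.rpow_nonneg (hc0 k).le (1 / r)
    rw [norm_smul, norm_inv, RCLike.norm_ofReal, abs_of_nonneg h, Real.mul_rpow (inv_nonneg.2 h)
      (norm_nonneg _), Real.inv_rpow h, ← Real.rpow_mul (hc0 k).le, one_div_mul_cancel hr.ne',
      Real.rpow_one]
    ring

end Factorization

/-! ### N^p ⊆ K_p ⊆ P_p^dual, and the return to small hulls -/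

section Inclusions

variable {𝕜 : Type} [RCLike 𝕜] {X Y : Type u} [NormedAddCommGroup X] [NormedSpace 𝕜 X]
  [NormedAddCommGroup Y] [NormedSpace 𝕜 Y] {p : ℝ≥0∞}

theorem summable_norm_lp_rpow (hp1 : 1 ≤ p) (hp : p ≠ ∞) (z : lp (fun _ : ℕ => X) p) :
    Summable fun k => ‖z k‖ ^ p.toReal :=
  (lp.memℓp z).summable (zero_lt_one.trans_le (one_le_toReal hp1 hp))

theorem isRelPCompact_of_inHull (hp1 : 1 ≤ p) (hp : p ≠ ∞) {K : Set X} {z : ℕ → X} {M : ℝ}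
    (hz : Summable fun k => ‖z k‖ ^ p.toReal) (hM : 0 ≤ M) (hK : ∀ v ∈ K, InHull 𝕜 p M z v) :
    IsRelPCompact 𝕜 p K := by
  have : Fact (1 ≤ p) := ⟨hp1⟩
  let z' : lp (fun _ : ℕ => X) p := ⟨z, memℓp_gen hz⟩
  -- M + 1 instead of M, because M may vanish.
  refine ⟨((M + 1 : ℝ) : 𝕜) • z', fun v hv => (mem_pConv_iff hp1 hp).2 ?_⟩
  have hc : (((M + 1 : ℝ) : 𝕜))⁻¹ ≠ 0 := by
    rw [Ne, inv_eq_zero, RCLike.ofReal_eq_zero]; linarith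
  have h := (hK v hv).rescale hc
  rw [inv_inv] at h
  refine h.mono ?_
  rw [norm_inv, RCLike.norm_ofReal, abs_of_pos (by linarith), inv_mul_le_one₀ (by linarith)]
  linarith

/-- Uniform boundedness for weakly `p*`-summable sequences of functionals. -/
theorem IsWeaklySummable.exists_dualBound [CompleteSpace Y] (hp1 : 1 ≤ p) (hp : p ≠ ∞)
    {f : ℕ → StrongDual 𝕜 Y} (hf : IsWeaklySummable 𝕜 p.conjExponent f) :
    ∃ C : ℝ, 0 ≤ C ∧ ∀ y, DualBound p.toReal (C * ‖y‖) fun n => f n y := by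
  have : Fact (1 ≤ p.conjExponent) := ⟨one_le_conjExponent p⟩
  have hmem : ∀ y, Memℓp (fun n => f n y) p.conjExponent := fun y =>
    hf (NormedSpace.inclusionInDoubleDual 𝕜 Y y)
  let L : Y →ₗ[𝕜] lp (fun _ : ℕ => 𝕜) p.conjExponent :=
    { toFun := fun y => ⟨fun n => f n y, hmem y⟩
      map_add' := fun y y' => lp.ext (funext fun n => map_add (f n) y y')
      map_smul' := fun c y => lp.ext (funext fun n => map_smul (f n) c y) }
  -- Closed graph theorem: convergence in ℓ_{p*} forces coordinatewise convergence.
  have hL : Continuous L := by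
    refine L.continuous_of_seq_closed_graph fun u y b hu hb => lp.ext (funext fun n => ?_)
    have h1 : Tendsto (fun j => f n (u j)) atTop (𝓝 (b n)) :=
      ((lp.evalCLM 𝕜 (fun _ : ℕ => 𝕜) p.conjExponent n).continuous.tendsto b).comp hb
    exact tendsto_nhds_unique h1 (((f n).continuous.tendsto y).comp hu)
  exact ⟨‖(⟨L, hL⟩ : Y →L[𝕜] _)‖, norm_nonneg _, fun y =>
    (dualBound_lp hp1 hp (L y)).mono ((⟨L, hL⟩ : Y →L[𝕜] _).le_opNorm y)⟩

theorem IsRightPNuclear.isPCompactOperator [CompleteSpace Y] (hp1 : 1 ≤ p) (hp : p ≠ ∞)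
    {T : Y →L[𝕜] X} (hT : IsRightPNuclear p T) : IsPCompactOperator p T := by
  have hr := one_le_toReal hp1 hp
  have hr0 : 0 < p.toReal := zero_lt_one.trans_le hr
  obtain ⟨σ, f, x, hσ, hf, ⟨B, hB⟩, hsum⟩ := hT
  obtain ⟨C, hC0, hC⟩ := hf.exists_dualBound hp1 hp
  -- For p = 1 the coefficients f_k(y) are merely bounded; the null factor c_k taken from σ_k brings
  -- them into c₀.
  obtain ⟨c, hc0, hc, hcs⟩ := exists_tendsto_zero_summable_inv_smul (𝕜 := 𝕜) hr0 (hσ.summable hr0)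
  obtain ⟨D, hD⟩ := hc.norm.bddAbove_range
  have hD' : ∀ k, ‖c k‖ ≤ D := fun k => hD ⟨k, rfl⟩
  have hD0 : 0 ≤ D := (norm_nonneg _).trans (hD' 0)
  have hB0 : 0 ≤ B := (norm_nonneg _).trans (hB 0)
  refine isRelPCompact_of_inHull hp1 hp (z := fun k => ((c k)⁻¹ • σ k) • x k) (M := D * C) ?_
    (by positivity) ?_
  · refine Summable.of_nonneg_of_le (fun k => by positivity) (fun k => ?_)
      (hcs.mul_right (B ^ p.toReal))
    rw [norm_smul, Real.mul_rpow (norm_nonneg _) (norm_nonneg _)]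
    gcongr
    exact hB k
  · rintro _ ⟨y, hy, rfl⟩
    have hy' : C * ‖y‖ ≤ C := mul_le_of_le_one_right hC0 (by simpa using hy)
    refine ⟨fun k => c k * f k y, ((hC y).mono hy').mul_bounded hD0 hD', fun _ => ?_, ?_⟩
    · rw [Nat.cofinite_eq_atTop]
      refine squeeze_zero_norm (fun k => ?_) (by simpa using hc.norm.mul_const C)
      rw [norm_mul]
      exact mul_le_mul_of_nonneg_left (((hC y).mono hy').norm_le k) (norm_nonneg _)
    · convert hsum y using 2 with k
      rw [smul_smul, smul_smul, smul_eq_mul]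
      congr 1
      field_simp [hc0 k]

theorem InHull.norm_apply_rpow_le (hp1 : 1 ≤ p) (hp : p ≠ ∞) {z : ℕ → X} {v : X}
    (hz : Summable fun k => ‖z k‖ ^ p.toReal) (h : InHull 𝕜 p 1 z v) (ψ : StrongDual 𝕜 X) :
    (Summable fun k => ‖ψ (z k)‖ ^ p.toReal) ∧
      ‖ψ v‖ ≤ (∑' k, ‖ψ (z k)‖ ^ p.toReal) ^ (1 / p.toReal) := by
  have hr0 : 0 < p.toReal := zero_lt_one.trans_le (one_le_toReal hp1 hp)
  obtain ⟨a, ha, -, hv⟩ := h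
  have hs : Summable fun k => ‖ψ (z k)‖ ^ p.toReal := by
    refine Summable.of_nonneg_of_le (fun k => by positivity) (fun k => ?_)
      (hz.mul_left (‖ψ‖ ^ p.toReal))
    rw [← Real.mul_rpow (norm_nonneg _) (norm_nonneg _)]
    gcongr
    exact ψ.le_opNorm _
  refine ⟨hs, ?_⟩
  have h1 := ψ.hasSum hv
  have h2 := ha.summable_mul hr0 zero_le_one (fun k => norm_nonneg (ψ (z k))) hs
  have h3 := ha.tsum_mul_le hr0 zero_le_one (fun k => norm_nonneg (ψ (z k))) hs
  rw [one_mul] at h3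
  refine le_trans ?_ h3
  rw [← h1.tsum_eq]
  refine tsum_of_norm_bounded h2.hasSum fun k => ?_
  simp

/-- Hölder gives ‖T*ψ‖^p ≤ ∑_k |ψ(z_k)|^p. After summing over the ψ_i and exchanging the sums, each
inner sum is controlled by evaluation at z_k, an element of the bidual of norm at most ‖z_k‖. -/
theorem IsPCompactOperator.isAbsolutelyPSumming_adjoint (hp1 : 1 ≤ p) (hp : p ≠ ∞)
    {T : Y →L[𝕜] X} (hT : IsPCompactOperator p T) :
    IsAbsolutelyPSumming p (adjointOperator T) := by
  have hr0 : 0 < p.toReal := zero_lt_one.trans_le (one_le_toReal hp1 hp)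
  obtain ⟨z, hz⟩ := hT
  have hzs := summable_norm_lp_rpow hp1 hp z
  unfold IsAbsolutelyPSumming
  set r := p.toReal with hrdef
  have hS0 : 0 ≤ ∑' k, ‖z k‖ ^ r := tsum_nonneg fun k => by positivity
  refine ⟨(∑' k, ‖z k‖ ^ r) ^ (1 / r), by positivity, fun m ψ w hw => ?_⟩
  have hw0 : 0 ≤ w := le_trans (by positivity) (hw 0 (by simp))
  have hball : ∀ y ∈ Metric.closedBall (0 : Y) 1, InHull 𝕜 p 1 (fun k => z k) (T y) := fun y hy =>
    (mem_pConv_iff hp1 hp).1 (hz ⟨y, hy, rfl⟩)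
  have hs : ∀ i, Summable fun k => ‖ψ i (z k)‖ ^ r := fun i =>
    ((hball 0 (by simp)).norm_apply_rpow_le hp1 hp hzs (ψ i)).1
  have hT : ∀ i, ‖adjointOperator T (ψ i)‖ ^ r ≤ ∑' k, ‖ψ i (z k)‖ ^ r := fun i => by
    have h0 : 0 ≤ ∑' k, ‖ψ i (z k)‖ ^ r := tsum_nonneg fun k => by positivity
    have h1 : ‖adjointOperator T (ψ i)‖ ≤ (∑' k, ‖ψ i (z k)‖ ^ r) ^ (1 / r) := by
      have := ContinuousLinearMap.opNorm_bound_of_ball_bound (𝕜 := 𝕜) one_pos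
        ((∑' k, ‖ψ i (z k)‖ ^ r) ^ (1 / r)) (adjointOperator T (ψ i)) fun y hy =>
          ((hball y hy).norm_apply_rpow_le hp1 hp hzs (ψ i)).2
      simpa using this
    calc _ ≤ ((∑' k, ‖ψ i (z k)‖ ^ r) ^ (1 / r)) ^ r := by gcongr
      _ = _ := by rw [← Real.rpow_mul h0, one_div_mul_cancel hr0.ne', Real.rpow_one]
  have hk : ∀ v : X, ∑ i, ‖ψ i v‖ ^ r ≤ ‖v‖ ^ r * w ^ r := fun v => by
    rcases eq_or_ne v 0 with rfl | hv
    · simp [Real.zero_rpow hr0.ne']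
    have hv' : (0 : ℝ) < ‖v‖ := norm_pos_iff.2 hv
    have h1 := hw ((‖v‖⁻¹ : 𝕜) • NormedSpace.inclusionInDoubleDual 𝕜 X v) <| by
      rw [norm_smul, norm_inv, RCLike.norm_ofReal, abs_norm, inv_mul_le_one₀ hv']
      exact NormedSpace.double_dual_bound 𝕜 X v
    have h2 : ∀ i, ‖((‖v‖⁻¹ : 𝕜) • NormedSpace.inclusionInDoubleDual 𝕜 X v) (ψ i)‖ ^ r
        = (‖v‖ ^ r)⁻¹ * ‖ψ i v‖ ^ r := fun i => by
      rw [smul_apply, norm_smul, norm_inv, RCLike.norm_ofReal, abs_norm,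
        NormedSpace.dual_def, Real.mul_rpow (by positivity) (norm_nonneg _),
        Real.inv_rpow hv'.le]
    simp only [h2, ← Finset.mul_sum] at h1
    have h3 := Real.rpow_le_rpow (by positivity) h1 hr0.le
    rw [← Real.rpow_mul (by positivity), one_div_mul_cancel hr0.ne', Real.rpow_one,
      inv_mul_le_iff₀ (by positivity)] at h3
    exact h3
  have hsum : ∑ i, ‖adjointOperator T (ψ i)‖ ^ r ≤ (∑' k, ‖z k‖ ^ r) * w ^ r := by
    refine (Finset.sum_le_sum fun i _ => hT i).trans ?_
    rw [← Summable.tsum_finsetSum fun i _ => hs i, ← tsum_mul_right]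
    exact Summable.tsum_le_tsum (fun k => hk (z k)) (summable_sum fun i _ => hs i)
      (hzs.mul_right _)
  calc _ ≤ ((∑' k, ‖z k‖ ^ r) * w ^ r) ^ (1 / r) := by gcongr
    _ = _ := by
      rw [Real.mul_rpow hS0 (by positivity), ← Real.rpow_mul hw0, mul_one_div_cancel hr0.ne',
        Real.rpow_one]

/-- The summing constant does not depend on the number of functionals, so N depends on ε only and
not on the block end L. -/
theorem isLocallyPNull_of_isAbsolutelyPSumming_adjoint (hp1 : 1 ≤ p) (hp : p ≠ ∞)
    {T : Y →L[𝕜] X} (hT : IsAbsolutelyPSumming p (adjointOperator T)) {y : ℕ → Y}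
    (hy : Tendsto y atTop (𝓝 0)) : IsLocallyPNull 𝕜 p fun n => T (y n) := by
  have hr := one_le_toReal hp1 hp
  have hr0 : 0 < p.toReal := zero_lt_one.trans_le hr
  obtain ⟨C, hC0, hC⟩ := hT
  unfold IsLocallyPNull
  set r := p.toReal with hrdef
  intro ε hε
  have hC1 : 0 < C + 1 := by linarith
  -- This makes s = ε/4. The two constants 2 of the finite-family lemma cost at most a factor 4, as
  -- 2 ≤ 2^r; C + 1 avoids dividing by zero.
  let δ := ε / (4 * (C + 1))
  have hδ : 0 < δ := by positivity
  let s := (C + 1) * δ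
  have hs : 0 < s := by positivity
  have hs' : s * 4 = ε := by simp only [s, δ]; field_simp
  obtain ⟨N, hN⟩ := eventually_atTop.1 ((Metric.tendsto_nhds.1 hy) δ hδ)
  refine ⟨N, fun L => ?_⟩
  obtain ⟨z, hz, hz2, hzx⟩ := exists_inHull_of_forall_dominated (𝕜 := 𝕜) hp1 hp
    (fun i : Fin (L - N) => ((s : 𝕜)⁻¹) • T (y (N + i))) fun ψ hψ => by
      -- The hypothesis on ψ concerns the ball of X, the summing inequality that of X**. Norming
      -- coefficients a bridge the gap: ‖∑ a_i ψ_i‖ ≤ 1 is checked on X alone, and Φ maps this sum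
      -- to the ℓ_p-norm sought.
      have hΦ : ∀ Φ : StrongDual 𝕜 (StrongDual 𝕜 X), ‖Φ‖ ≤ 1 →
          (∑ i, ‖Φ (ψ i)‖ ^ r) ^ (1 / r) ≤ 1 := fun Φ hΦ1 => by
        obtain ⟨a, ha1, ha2⟩ := exists_dualBound_sum_eq hp1 hp fun i => Φ (ψ i)
        have h1 : ‖∑ i, a i • ψ i‖ ≤ 1 := by
          have := ContinuousLinearMap.opNorm_bound_of_ball_bound (𝕜 := 𝕜) one_pos 1
            (∑ i, a i • ψ i) fun u hu => by
              rw [sum_apply]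
              refine (ha1.norm_sum_mul_le _ fun i => ψ i u).trans ?_
              rw [one_mul]
              exact Real.rpow_le_one (by positivity) (hψ u (by simpa using hu)) (by positivity)
          simpa using this
        have h2 : Φ (∑ i, a i • ψ i) = (((∑ i, ‖Φ (ψ i)‖ ^ r) ^ (1 / r) : ℝ) : 𝕜) := by
          rw [← ha2]; simp
        calc (∑ i, ‖Φ (ψ i)‖ ^ r) ^ (1 / r) = ‖Φ (∑ i, a i • ψ i)‖ := by
              rw [h2, RCLike.norm_ofReal, abs_of_nonneg (by positivity)]
          _ ≤ 1 * ‖∑ i, a i • ψ i‖ := Φ.le_of_opNorm_le hΦ1 _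
          _ ≤ 1 := by linarith
      have h1 := hC _ ψ 1 hΦ
      rw [mul_one] at h1
      have h2 := Real.rpow_le_rpow (by positivity) h1 hr0.le
      rw [← Real.rpow_mul (by positivity), one_div_mul_cancel hr0.ne', Real.rpow_one] at h2
      have h3 : ∀ i : Fin (L - N), ‖ψ i ((s : 𝕜)⁻¹ • T (y (N + i)))‖ ^ r
          ≤ ((C + 1)⁻¹) ^ r * ‖adjointOperator T (ψ i)‖ ^ r := fun i => by
        rw [← Real.mul_rpow (by positivity) (norm_nonneg _)]
        refine Real.rpow_le_rpow (norm_nonneg _) ?_ hr0.le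
        rw [map_smul, norm_smul, norm_inv, RCLike.norm_ofReal, abs_of_pos hs]
        have h4 : ‖ψ i (T (y (N + i)))‖ ≤ ‖adjointOperator T (ψ i)‖ * δ := by
          refine ((adjointOperator T (ψ i)).le_opNorm (y (N + i))).trans ?_
          gcongr
          simpa using (hN (N + i) (Nat.le_add_right _ _)).le
        calc s⁻¹ * ‖ψ i (T (y (N + i)))‖ ≤ s⁻¹ * (‖adjointOperator T (ψ i)‖ * δ) := by gcongr
          _ = _ := by simp only [s]; field_simp
      refine (Finset.sum_le_sum fun i _ => h3 i).trans ?_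
      rw [← Finset.mul_sum]
      calc _ ≤ ((C + 1)⁻¹) ^ r * C ^ r := by gcongr
        _ = ((C + 1)⁻¹ * C) ^ r := by rw [Real.mul_rpow (by positivity) hC0]
        _ ≤ 1 := Real.rpow_le_one (by positivity)
            (by rw [inv_mul_le_one₀ hC1]; linarith) hr0.le
  have hc : ((2 * s : ℝ) : 𝕜)⁻¹ ≠ 0 := by
    rw [Ne, inv_eq_zero, RCLike.ofReal_eq_zero]; positivity
  have hcn : ‖((2 * s : ℝ) : 𝕜)⁻¹‖ = (2 * s)⁻¹ := by
    rw [norm_inv, RCLike.norm_ofReal, abs_of_pos (by positivity)]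
  have hw : ∀ k, ‖(((2 * s : ℝ) : 𝕜)⁻¹)⁻¹ • z k‖ ^ r = (2 * s) ^ r * ‖z k‖ ^ r := fun k => by
    rw [norm_smul, norm_inv, hcn, inv_inv, Real.mul_rpow (by positivity) (norm_nonneg _)]
  refine ⟨fun k => (((2 * s : ℝ) : 𝕜)⁻¹)⁻¹ • z k, ?_, ?_, fun n hn hnL => ?_⟩
  · simp only [hw]; exact hz.mul_left _
  · simp only [hw, tsum_mul_left]
    have h2 : (2 : ℝ) ≤ 2 ^ r := by
      simpa using Real.rpow_le_rpow_of_exponent_le (one_le_two (α := ℝ)) hr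
    calc _ ≤ (2 * s) ^ r * 2 ^ r := by gcongr; exact hz2.trans h2
      _ = ε ^ r := by rw [← Real.mul_rpow (by positivity) (by positivity), ← hs']; ring_nf
  · have h1 := ((hzx ⟨n - N, by omega⟩).smul (s : 𝕜)).rescale hc
    rw [hcn, RCLike.norm_ofReal, abs_of_pos hs] at h1
    have hs0 : (s : 𝕜) ≠ 0 := by simpa using hs.ne'
    convert h1 using 1
    · field_simp
    · rw [smul_smul, mul_inv_cancel₀ hs0, one_smul]
      simp [Nat.add_sub_cancel' hn]

end Inclusions

/-! ### Operators on ℓ_{p*} synthesizing p-convex hulls -/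

section SequenceSpace

variable {𝕜 : Type} [RCLike 𝕜] {X : Type u} [NormedAddCommGroup X] [NormedSpace 𝕜 X]
  {p : ℝ≥0∞}

instance fact_one_le_conjExponent : Fact (1 ≤ p.conjExponent) := ⟨one_le_conjExponent p⟩

variable (𝕜 p) in
/-- The sequence space `ℓ_{p*}`, lifted to the universe of the Banach spaces considered. -/
abbrev LiftedDualSeq : Type u := ULift.{u} (lp (fun _ : ℕ => 𝕜) p.conjExponent)

instance : CompleteSpace (LiftedDualSeq.{u} 𝕜 p) :=
  (completeSpace_congr (e := Equiv.ulift) (LinearIsometryEquiv.ulift 𝕜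
    (lp (fun _ : ℕ => 𝕜) p.conjExponent)).isometry.isUniformEmbedding).2 inferInstance

/-- The coordinate functionals form a weakly `p*`-summable sequence in the dual of `ℓ_{p*}`. -/
theorem isWeaklySummable_coord (hp1 : 1 ≤ p) (hp : p ≠ ∞)
    {f : ℕ → StrongDual 𝕜 (LiftedDualSeq.{u} 𝕜 p)} (hf : ∀ k y, f k y = y.down k) :
    IsWeaklySummable 𝕜 p.conjExponent f := by
  intro Φ
  refine DualBound.memℓp hp1 hp (norm_nonneg Φ) fun s b hb => ?_
  have hb0 : 0 ≤ ∑ k ∈ s, b k ^ p.toReal :=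
    Finset.sum_nonneg fun k _ => Real.rpow_nonneg (hb k) _
  choose θ hθ1 hθ2 using fun k => RCLike.exists_norm_eq_mul_self (K := 𝕜) (Φ (f k))
  have h1 : ‖∑ k ∈ s, (θ k * (b k : 𝕜)) • f k‖ ≤ (∑ k ∈ s, b k ^ p.toReal) ^ (1 / p.toReal) := by
    refine ContinuousLinearMap.opNorm_le_bound _ (Real.rpow_nonneg hb0 _) fun y => ?_
    rw [sum_apply]
    refine (norm_sum_le _ _).trans ?_
    refine le_trans (Finset.sum_le_sum fun k _ => ?_)
      ((dualBound_lp hp1 hp y.down s b hb).trans_eq (mul_comm _ _))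
    rw [smul_apply, norm_smul, norm_mul, hθ1, one_mul, RCLike.norm_ofReal, abs_of_nonneg (hb k),
      hf, mul_comm]
  have h2 : Φ (∑ k ∈ s, (θ k * (b k : 𝕜)) • f k) = ((∑ k ∈ s, ‖Φ (f k)‖ * b k : ℝ) : 𝕜) := by
    rw [map_sum, RCLike.ofReal_sum]
    refine Finset.sum_congr rfl fun k _ => ?_
    rw [RCLike.ofReal_mul, hθ2, map_smul, smul_eq_mul]
    ring
  calc ∑ k ∈ s, ‖Φ (f k)‖ * b k = ‖Φ (∑ k ∈ s, (θ k * (b k : 𝕜)) • f k)‖ := by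
        rw [h2, RCLike.norm_ofReal, abs_of_nonneg]
        exact Finset.sum_nonneg fun k _ => mul_nonneg (norm_nonneg _) (hb k)
    _ ≤ ‖Φ‖ * ‖∑ k ∈ s, (θ k * (b k : 𝕜)) • f k‖ := Φ.le_opNorm _
    _ ≤ _ := mul_le_mul_of_nonneg_left h1 (norm_nonneg _)

theorem exists_isRightPNuclear_hasSum [CompleteSpace X] (hp1 : 1 ≤ p) (hp : p ≠ ∞) {z : ℕ → X}
    (hz : Summable fun k => ‖z k‖ ^ p.toReal) :
    ∃ T : LiftedDualSeq.{u} 𝕜 p →L[𝕜] X, IsRightPNuclear p T ∧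
      ∀ y, HasSum (fun k => y.down k • z k) (T y) := by
  have hr0 : 0 < p.toReal := zero_lt_one.trans_le (one_le_toReal hp1 hp)
  have hsum : ∀ y : LiftedDualSeq.{u} 𝕜 p, Summable fun k => ‖y.down k‖ * ‖z k‖ := fun y =>
    (dualBound_lp hp1 hp y.down).summable_mul hr0 (norm_nonneg _) (fun k => norm_nonneg (z k)) hz
  have hs : ∀ y : LiftedDualSeq.{u} 𝕜 p, Summable fun k => y.down k • z k := fun y =>
    Summable.of_norm (by simpa only [norm_smul] using hsum y)
  let T₀ : LiftedDualSeq.{u} 𝕜 p →ₗ[𝕜] X :=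
    { toFun := fun y => ∑' k, y.down k • z k
      map_add' := fun y y' => by
        rw [← (hs y).tsum_add (hs y')]
        exact tsum_congr fun k => add_smul _ _ _
      map_smul' := fun c y => by
        rw [RingHom.id_apply, ← (hs y).tsum_const_smul c]
        exact tsum_congr fun k => mul_smul _ _ _ }
  let T : LiftedDualSeq.{u} 𝕜 p →L[𝕜] X :=
    T₀.mkContinuous ((∑' k, ‖z k‖ ^ p.toReal) ^ (1 / p.toReal)) fun y => by
      refine le_trans ?_ (((dualBound_lp hp1 hp y.down).tsum_mul_le hr0 (norm_nonneg _)
        (fun k => norm_nonneg (z k)) hz).trans_eq (mul_comm _ _))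
      refine tsum_of_norm_bounded (hsum y).hasSum fun k => ?_
      rw [norm_smul]
  have hT : ∀ y, HasSum (fun k => y.down k • z k) (T y) := fun y => (hs y).hasSum
  -- σ_k = ‖z_k‖ and x_k = z_k/‖z_k‖; where z_k = 0, the convention 0⁻¹ = 0 gives x_k = 0.
  refine ⟨T, ⟨fun k => ((‖z k‖ : ℝ) : 𝕜), fun k => (lp.evalCLM 𝕜 (fun _ : ℕ => 𝕜) _ k).comp
    (LinearIsometryEquiv.ulift 𝕜 _).toContinuousLinearEquiv.toContinuousLinearMap,
    fun k => ((‖z k‖ : ℝ) : 𝕜)⁻¹ • z k, memℓp_gen (by simpa using hz),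
    isWeaklySummable_coord hp1 hp fun k y => rfl, ⟨1, fun k => ?_⟩, fun y => ?_⟩, hT⟩
  · rw [norm_smul, norm_inv, RCLike.norm_ofReal, abs_norm]
    exact inv_mul_le_one
  · convert hT y using 2 with k
    change ((‖z k‖ : ℝ) : 𝕜) • y.down k • ((‖z k‖ : ℝ) : 𝕜)⁻¹ • z k = _
    rcases eq_or_ne (z k) 0 with h | h
    · simp [h]
    · have hk : ((‖z k‖ : ℝ) : 𝕜) ≠ 0 := by simpa using h
      rw [smul_comm, smul_inv_smul₀ hk]

/-- A diagonal operator has norm at most any bound on its entries, so the finite-rank truncations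
converge in norm. -/
theorem exists_diagonal_isCompactOperator (hp1 : 1 ≤ p) (hp : p ≠ ∞) {c : ℕ → 𝕜}
    (hc : Tendsto c atTop (𝓝 0)) :
    ∃ D : lp (fun _ : ℕ => 𝕜) p.conjExponent →L[𝕜] lp (fun _ : ℕ => 𝕜) p.conjExponent,
      IsCompactOperator D ∧ ∀ a k, D a k = c k * a k := by
  have diag : ∀ (d : ℕ → 𝕜) (C : ℝ), (∀ k, ‖d k‖ ≤ C) →
      ∃ D : lp (fun _ : ℕ => 𝕜) p.conjExponent →L[𝕜] lp (fun _ : ℕ => 𝕜) p.conjExponent,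
        ‖D‖ ≤ C ∧ ∀ a k, D a k = d k * a k := fun d C hd => by
    have hC : 0 ≤ C := (norm_nonneg _).trans (hd 0)
    have hb := fun a : lp (fun _ : ℕ => 𝕜) p.conjExponent =>
      (dualBound_lp hp1 hp a).mul_bounded hC hd
    let D₀ : lp (fun _ : ℕ => 𝕜) p.conjExponent →ₗ[𝕜] lp (fun _ : ℕ => 𝕜) p.conjExponent :=
      { toFun := fun a => ⟨fun k => d k * a k,
          (hb a).memℓp hp1 hp (mul_nonneg hC (norm_nonneg a))⟩
        map_add' := fun a b => lp.ext (funext fun k => mul_add _ _ _)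
        map_smul' := fun t a => lp.ext (funext fun k => mul_left_comm _ _ _) }
    exact ⟨D₀.mkContinuous C fun a =>
      DualBound.norm_lp_le hp1 hp (mul_nonneg hC (norm_nonneg a)) (hb a),
      LinearMap.mkContinuous_norm_le _ hC _, fun a k => rfl⟩
  obtain ⟨C, hC⟩ := hc.norm.bddAbove_range
  obtain ⟨D, -, hD⟩ := diag c C fun k => hC ⟨k, rfl⟩
  refine ⟨D, ?_, hD⟩
  let F : ℕ → (lp (fun _ : ℕ => 𝕜) p.conjExponent →L[𝕜] lp (fun _ : ℕ => 𝕜) p.conjExponent) :=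
    fun n => ∑ k ∈ Finset.range n, (ContinuousLinearMap.toSpanSingleton 𝕜
      (c k • lp.single p.conjExponent k (1 : 𝕜))).comp (lp.evalCLM 𝕜 (fun _ : ℕ => 𝕜) _ k)
  have hF : ∀ n a j, F n a j = if j < n then c j * a j else 0 := fun n a j => by
    have h1 : F n a = ∑ k ∈ Finset.range n, a k • c k •
        (lp.single p.conjExponent k (1 : 𝕜) : lp (fun _ : ℕ => 𝕜) p.conjExponent) := by
      simp only [F, sum_apply]
      rfl
    rw [h1, lp.coeFn_sum, Finset.sum_apply]
    simp only [lp.coeFn_smul, Pi.smul_apply, lp.single_apply, smul_eq_mul, Pi.single_apply,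
      mul_ite, mul_one, mul_zero, Finset.sum_ite_eq, Finset.mem_range]
    simp only [mul_comm]
  refine isCompactOperator_of_tendsto (l := atTop) (F := F) ?_ (Eventually.of_forall fun n => ?_)
  · rw [tendsto_iff_norm_sub_tendsto_zero, Metric.tendsto_atTop]
    intro ε hε
    obtain ⟨N, hN⟩ := Metric.tendsto_atTop.1 hc (ε / 2) (by positivity)
    refine ⟨N, fun n hn => ?_⟩
    obtain ⟨E, hE1, hE⟩ := diag (fun k => if k < n then 0 else -c k) (ε / 2) fun k => by
      split_ifs with h
      · simpa using (half_pos hε).le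
      · simpa using (hN k (by omega)).le
    have : F n - D = E := by
      ext a k
      rw [sub_apply, lp.coeFn_sub, Pi.sub_apply, hF, hD, hE]
      split_ifs <;> simp
    rw [this, dist_zero_right, norm_norm]
    linarith
  · refine Submodule.sum_mem (compactOperator (RingHom.id 𝕜) _ _) fun k _ => ?_
    have h := isCompactOperator_of_locallyCompactSpace_rng (ContinuousLinearMap.toSpanSingleton 𝕜
      (c k • (lp.single p.conjExponent k (1 : 𝕜) : lp (fun _ : ℕ => 𝕜) p.conjExponent)))
    exact h.comp_clm _

variable [CompleteSpace X] {x : ℕ → X}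

/-- Write a_k z_k = (c_k a_k)(c_k⁻¹ z_k) with c_k → 0: the diagonal operator c maps the unit ball to
a relatively compact set, and the rescaled z still defines a right p-nuclear operator. -/
theorem IsRelPCompact.isCompactSet_rightPNuclear (hp1 : 1 ≤ p) (hp : p ≠ ∞) {K : Set X}
    (h : IsRelPCompact 𝕜 p K) : (rightPNuclear.{u} 𝕜 p).IsCompactSet K := by
  have hr0 : 0 < p.toReal := zero_lt_one.trans_le (one_le_toReal hp1 hp)
  obtain ⟨z, hz⟩ := h
  obtain ⟨c, hc0, hc, hcs⟩ :=
    exists_tendsto_zero_summable_inv_smul (𝕜 := 𝕜) hr0 (summable_norm_lp_rpow hp1 hp z)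
  obtain ⟨T, hT, hTs⟩ := exists_isRightPNuclear_hasSum (𝕜 := 𝕜) hp1 hp hcs
  obtain ⟨D, hD, hDc⟩ := exists_diagonal_isCompactOperator hp1 hp hc
  let e : LiftedDualSeq.{u} 𝕜 p ≃ₗᵢ[𝕜] lp (fun _ : ℕ => 𝕜) p.conjExponent :=
    LinearIsometryEquiv.ulift 𝕜 _
  have hcomp : IsCompactOperator
      (e.symm.toContinuousLinearEquiv.toContinuousLinearMap.comp D) :=
    hD.clm_comp e.symm.toContinuousLinearEquiv.toContinuousLinearMap
  refine ⟨LiftedDualSeq.{u} 𝕜 p, _, _, inferInstance, _, T, hT,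
    hcomp.isCompact_closure_image_closedBall 1, fun v hv => ?_⟩
  obtain ⟨a, ha, -, hav⟩ := hz hv
  refine ⟨e.symm (D a), ⟨a, by simpa using ha, rfl⟩, (hTs _).unique ?_⟩
  convert hav using 2 with k
  change D a k • (c k)⁻¹ • z k = _
  rw [hDc, smul_smul, mul_right_comm, mul_inv_cancel₀ (hc0 k), one_mul]

theorem IsHullNull.isNullSeq_rightPNuclear (hp1 : 1 ≤ p) (hp : p ≠ ∞) (h : IsHullNull 𝕜 p x) :
    (rightPNuclear.{u} 𝕜 p).IsNullSeq x := by
  obtain ⟨z, hz, t, ht, hx⟩ := h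
  obtain ⟨T, hT, hTs⟩ := exists_isRightPNuclear_hasSum (𝕜 := 𝕜) hp1 hp hz
  choose ht0 a ha _ hax using hx
  refine ⟨LiftedDualSeq.{u} 𝕜 p, _, _, inferInstance,
    fun n => ULift.up ⟨a n, (ha n).memℓp hp1 hp (ht0 n)⟩, T, hT, ?_,
    fun n => (hax n).unique (hTs _)⟩
  exact squeeze_zero_norm (fun n => DualBound.norm_lp_le hp1 hp (ht0 n) (ha n)) ht

end SequenceSpace

/-! ### p-null and uniformly p-null sequences -/

section PNull

variable {𝕜 : Type} [RCLike 𝕜] {X : Type u} [NormedAddCommGroup X] [NormedSpace 𝕜 X]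
  {p : ℝ≥0∞} {x : ℕ → X}

theorem IsHullNull.isRelPCompact (hp1 : 1 ≤ p) (hp : p ≠ ∞) (h : IsHullNull 𝕜 p x) :
    IsRelPCompact 𝕜 p (Set.range x) := by
  obtain ⟨z, hz, t, ht, hx⟩ := h
  obtain ⟨M, hM⟩ := ht.bddAbove_range
  have hM' : ∀ n, t n ≤ M := fun n => hM ⟨n, rfl⟩
  refine isRelPCompact_of_inHull hp1 hp hz ((hx 0).1.trans (hM' 0)) ?_
  rintro _ ⟨n, rfl⟩
  exact (hx n).2.mono (hM' n)

theorem IsHullNull.isUniformlyPNull (hp1 : 1 ≤ p) (hp : p ≠ ∞) (h : IsHullNull 𝕜 p x) :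
    IsUniformlyPNull 𝕜 p x := by
  have : Fact (1 ≤ p) := ⟨hp1⟩
  obtain ⟨z, hz, t, ht, hx⟩ := h
  let z' : lp (fun _ : ℕ => X) p := ⟨z, memℓp_gen hz⟩
  have hA : 0 < ‖z'‖ + 1 := by positivity
  have hA0 : ((‖z'‖ + 1 : ℝ) : 𝕜) ≠ 0 := by rw [Ne, RCLike.ofReal_eq_zero]; exact hA.ne'
  refine ⟨((‖z'‖ + 1 : ℝ) : 𝕜)⁻¹ • z', ?_, fun ε hε => ?_⟩
  · rw [norm_smul, norm_inv, RCLike.norm_ofReal, abs_of_pos hA, inv_mul_le_one₀ hA]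
    linarith
  · have hε0 : (ε : 𝕜) ≠ 0 := by simpa using hε.ne'
    obtain ⟨N, hN⟩ := eventually_atTop.1
      (ht.eventually_le_const (show 0 < ε / (‖z'‖ + 1) by positivity))
    refine ⟨N, fun n hn => ?_⟩
    rw [Set.mem_smul_set_iff_inv_smul_mem₀ hε0, mem_pConv_iff hp1 hp]
    refine (((hx n).2.rescale hA0).smul (ε : 𝕜)⁻¹).mono ?_
    rw [norm_inv, RCLike.norm_ofReal, RCLike.norm_ofReal, abs_of_pos hA, abs_of_pos hε,
      inv_mul_le_one₀ hε, ← le_div_iff₀' hA]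
    exact hN n hn

theorem IsUniformlyPNull.isPNull (hp1 : 1 ≤ p) (hp : p ≠ ∞) (h : IsUniformlyPNull 𝕜 p x) :
    IsPNull 𝕜 p x := by
  have : Fact (1 ≤ p) := ⟨hp1⟩
  obtain ⟨z, hz, hx⟩ := h
  intro ε hε
  have hε0 : (ε : 𝕜) ≠ 0 := by simpa using hε.ne'
  obtain ⟨N, hN⟩ := hx ε hε
  refine ⟨(ε : 𝕜) • z, ?_, N, fun n hn => ?_⟩
  · rw [norm_smul, RCLike.norm_ofReal, abs_of_pos hε]
    exact mul_le_of_le_one_right hε.le hz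
  · have h1 := hN n hn
    rw [Set.mem_smul_set_iff_inv_smul_mem₀ hε0, mem_pConv_iff hp1 hp] at h1
    rw [mem_pConv_iff hp1 hp]
    have h2 := (h1.smul (ε : 𝕜)).rescale (inv_ne_zero hε0)
    rw [smul_smul, mul_inv_cancel₀ hε0, one_smul, inv_inv, norm_inv, mul_one,
      inv_mul_cancel₀ (norm_ne_zero_iff.2 hε0)] at h2
    exact h2

theorem IsPNull.isLocallyPNull (hp1 : 1 ≤ p) (hp : p ≠ ∞) (h : IsPNull 𝕜 p x) :
    IsLocallyPNull 𝕜 p x := by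
  have hr0 : 0 < p.toReal := zero_lt_one.trans_le (one_le_toReal hp1 hp)
  intro ε hε
  obtain ⟨z, hz, N, hN⟩ := h ε hε
  refine ⟨N, fun L => ⟨fun k => z k, summable_norm_lp_rpow hp1 hp z, ?_,
    fun n hn _ => (mem_pConv_iff hp1 hp).1 (hN n hn)⟩⟩
  rw [← lp.norm_rpow_eq_tsum hr0]
  exact Real.rpow_le_rpow (lp.norm_nonneg' z) hz hr0.le

theorem OperatorClass.IsNullSeq.isLocallyPNull [CompleteSpace X] (hp1 : 1 ≤ p) (hp : p ≠ ∞)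
    (h : (pSumming.{u} 𝕜 p).dual.IsNullSeq x) : IsLocallyPNull 𝕜 p x := by
  obtain ⟨Y, _, _, _, y, T, hT, hy, hxy⟩ := h
  rw [show x = fun n => T (y n) from funext hxy]
  exact isLocallyPNull_of_isAbsolutelyPSumming_adjoint hp1 hp hT hy

end PNull

/-! ### The equivalences -/

theorem corollary3p4 {𝕜 : Type} [RCLike 𝕜] {X : Type u} [NormedAddCommGroup X]
    [NormedSpace 𝕜 X] [CompleteSpace X] (p : ℝ≥0∞) (hp1 : 1 ≤ p) (hp : p ≠ ∞) (x : ℕ → X) :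
    List.TFAE [
      IsPNull 𝕜 p x,
      Tendsto x atTop (𝓝 0) ∧ IsRelPCompact 𝕜 p (Set.range x),
      Tendsto x atTop (𝓝 0) ∧ (rightPNuclear.{u} 𝕜 p).IsCompactSet (Set.range x),
      Tendsto x atTop (𝓝 0) ∧ (pCompact.{u} 𝕜 p).IsCompactSet (Set.range x),
      Tendsto x atTop (𝓝 0) ∧ (pSumming.{u} 𝕜 p).dual.IsCompactSet (Set.range x),
      (rightPNuclear.{u} 𝕜 p).IsNullSeq x,
      (pCompact.{u} 𝕜 p).IsNullSeq x,
      (pSumming.{u} 𝕜 p).dual.IsNullSeq x,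
      IsUniformlyPNull 𝕜 p x] := by
  -- Turns (c), (d), (e) literally into (f), (g), (h); one cycle through the other six statements
  -- remains.
  rw [← OperatorClass.isNullSeq_iff, ← OperatorClass.isNullSeq_iff, ← OperatorClass.isNullSeq_iff]
  have hnull : IsPNull 𝕜 p x → IsHullNull 𝕜 p x := fun h =>
    (h.isLocallyPNull hp1 hp).isHullNull hp1 hp
  tfae_have 1 → 2 := fun h =>
    ⟨((hnull h).isNullSeq_rightPNuclear hp1 hp).tendsto, (hnull h).isRelPCompact hp1 hp⟩
  tfae_have 2 → 3 := fun h => (h.2.isCompactSet_rightPNuclear hp1 hp).isNullSeq h.1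
  tfae_have 3 → 4 := fun h => h.mono fun Y X _ _ _ _ _ _ _ hT => hT.isPCompactOperator hp1 hp
  tfae_have 4 → 5 := fun h =>
    h.mono fun Y X _ _ _ _ _ _ _ hT => hT.isAbsolutelyPSumming_adjoint hp1 hp
  tfae_have 5 → 9 := fun h =>
    ((h.isLocallyPNull hp1 hp).isHullNull hp1 hp).isUniformlyPNull hp1 hp
  tfae_have 9 → 1 := fun h => h.isPNull hp1 hp
  tfae_have 3 ↔ 6 := Iff.rfl
  tfae_have 4 ↔ 7 := Iff.rfl
  tfae_have 5 ↔ 8 := Iff.rfl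
  tfae_finish
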